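/- **Setting.** Let $K$ be a compact connected metric space with more than one point, and let $F_0,\dots,F_{N-1}:K\to K$ be injective contractions with $K=\bigcup_l F_lK$. For a word $w=w_1\cdots w_m$ put $F_w=F_{w_1}\circ\cdots\circ F_{w_m}$. Suppose there is a finite set $V_0\subset K$, each of whose points is a fixed point of some $F_l$, such that $F_wK\cap F_{w'}K\subset F_wV_0\cap F_{w'}V_0$ for all words $w\ne w'$ of equal length (a p.c.f. self-similar structure). Put $V_m=\bigcup_{|w|=m}F_wV_0$ and $V_*=\bigcup_m V_m$. Let a regular harmonic structure be given: symmetric conductances $c_{pq}\ge 0$ ($p,q\in V_0$), whose energy $\mathcal E_0(f)=\sum_{\{p,q\}}c_{pq}(f(p)-f(q))^2$ vanishes only for constant $f$ on $V_0$, and factors $0<r_l<1$ such that, with $r_w=r_{w_1}\cdots r_{w_m}$ and $\mathcal E_m(f)=\sum_{|w|=m}r_w^{-1}\mathcal E_0(f\circ F_w)$, the minimum of $\mathcal E_1(f')$ over all extensions $f'$ of any $f:V_0\to\mathbb R$ is $\mathcal E_0(f)$. Let $\mu$ be the self-similar probability measure with weights $\mu_l>0$, $\sum_l\mu_l=1$,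 i.e. $\mu(B)=\sum_l\mu_l\,\mu(F_l^{-1}B)$ for all Borel sets $B$, and put $\mu_w=\mu_{w_1}\cdots\mu_{w_m}$. A continuous function $h$ on $K$ is harmonic if, for every $m\ge 0$, it minimizes $\mathcal E_{m+1}$ among the functions with the same values on $V_m$. For $x\in V_m\setminus V_0$ let $\psi_x^m$ be the continuous function with $\psi_x^m\circ F_w$ harmonic for all $|w|=m$, equal to $1$ at $x$ and to $0$ on $V_m\setminus\{x\}$, and set $$\tilde\Delta_mf(x)=\Big(\int_K\psi_x^m\,d\mu\Big)^{-1}\sum_{y\in V_m}c^{(m)}_{xy}\,(f(y)-f(x)),$$ where $c^{(m)}_{xy}$ is the sum of $r_w^{-1}c_{pq}$ over all $|w|=m$ and $p,q\in V_0$ with $F_wp=x$, $F_wq=y$. One writes $f\in\mathrm{dom}\,\Delta_\mu$, $\Delta_\mu f=g$ if $f,g$ are continuous on $K$ and $\tilde\Delta_mf\to g$ uniformly on $V_*\setminus V_0$ (that is, $\sup_{x\in V_m\setminus V_0}|\tilde\Delta_mf(x)-g(x)|\to0$); $\Delta_\mu^n$ is the $n$-fold iterate, and $\mathcal H_{n-1}$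 is the space of $h$ with $\Delta_\mu^nh=0$. **Theorem 5.4 (Calculation of $\Delta_\mu^n$).** Let $n\ge1$, $l\in\mathbb N$, $y_1,\dots,y_l\in V_*$, $a_1,\dots,a_l\in\mathbb R$, and let $A\neq0$ be a constant such that $$\sum_{j=1}^la_jh(y_j)=0\quad\text{for all }h\in\mathcal H_{n-1},\qquad \sum_{j=1}^la_jh'(y_j)=A\quad\text{for all }h'\text{ with }\Delta_\mu^nh'=1 .$$ Then for every $f\in\mathrm{dom}(\Delta_\mu^n)$, $$\Delta_\mu^nf(x)=\lim_{m\to\infty}A^{-1}\,(r_{[w]_m}\mu_{[w]_m})^{-n}\sum_{j=1}^la_j\,f(F_{[w]_m}y_j)$$ uniformly in $x\in K$ and in the infinite words $w$ corresponding to $x$. Here $[w]_m$ is the word of the first $m$ letters of $w$, and $w$ corresponds to $x$ if $x\in F_{[w]_m}K$ for every $m\ge0$. -/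

import Mathlib

open MeasureTheory Filter Topology
open scoped NNReal

namespace PCF

/-- `F_w = F_{w_1} ∘ ⋯ ∘ F_{w_m}` for a word `w = w_1 ⋯ w_m` of length `m`. -/
def wordMap {K : Type*} {N : ℕ} (F : Fin N → K → K) : (m : ℕ) → (Fin m → Fin N) → K → K
  | 0, _ => id
  | m + 1, w => F (w 0) ∘ wordMap F m (Fin.tail w)

/-- `t_w = t_{w_1} ⋯ t_{w_m}` for a family of numbers `t` and a word `w` of length `m`. -/
def wordProd {N : ℕ} (t : Fin N → ℝ) {m : ℕ} (w : Fin m → Fin N) : ℝ := ∏ i, t (w i)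

/-- The truncation `[ω]_m`: the first `m` letters of the infinite word `ω`. -/
def truncate {N : ℕ} (ω : ℕ → Fin N) (m : ℕ) : Fin m → Fin N := fun i => ω i

/-- A p.c.f. self-similar structure on `K` (which is taken to be compact and connected):
finitely many injective contractions whose images cover `K`, and a finite boundary set `V0`
consisting of fixed points of the maps, such that distinct cells of the same level
meet only at images of boundary points. -/
structure SelfSimilarStructure (K : Type*) [MetricSpace K] (N : ℕ) where
  F : Fin N → K → K
  contracting : ∀ l, ∃ κ : ℝ≥0, ContractingWith κ (F l)
  injective : ∀ l, Function.Injective (F l)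
  cover : ⋃ l, Set.range (F l) = Set.univ
  V0 : Finset K
  fixed : ∀ q ∈ V0, ∃ l, F l q = q
  inter_subset : ∀ (m : ℕ) (w w' : Fin m → Fin N), w ≠ w' →
    Set.range (wordMap F m w) ∩ Set.range (wordMap F m w') ⊆
      (wordMap F m w '' (V0 : Set K)) ∩ (wordMap F m w' '' (V0 : Set K))

/-- The level-zero energy `∑_{p ∼ q} c_{pq} (f p - f q) (g p - g q)`, each unordered pair of
boundary points being counted once. -/
noncomputable def energyZero {K : Type*} (V0 : Finset K) (c : K → K → ℝ) (f g : K → ℝ) : ℝ :=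
  (1 / 2) * ∑ p ∈ V0, ∑ q ∈ V0, c p q * (f p - f q) * (g p - g q)

/-- The renormalized level-`m` energy `∑_{|w| = m} r_w⁻¹ E_0 (f ∘ F_w, g ∘ F_w)`. -/
noncomputable def energyLevel {K : Type*} {N : ℕ} (F : Fin N → K → K) (V0 : Finset K)
    (c : K → K → ℝ) (r : Fin N → ℝ) (m : ℕ) (f g : K → ℝ) : ℝ :=
  ∑ w : Fin m → Fin N,
    (wordProd r w)⁻¹ * energyZero V0 c (f ∘ wordMap F m w) (g ∘ wordMap F m w)

namespace SelfSimilarStructure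

variable {K : Type*} [MetricSpace K] {N : ℕ} (S : SelfSimilarStructure K N)

/-- The map `F_w`. -/
def cellMap {m : ℕ} (w : Fin m → Fin N) : K → K := wordMap S.F m w

open Classical in
/-- The vertices `V_m = ⋃_{|w| = m} F_w V_0` of the graph of level `m`. -/
noncomputable def V (m : ℕ) : Finset K :=
  Finset.univ.biUnion fun w : Fin m → Fin N => S.V0.image (S.cellMap w)

/-- `V_* = ⋃_m V_m`. -/
def Vstar : Set K := ⋃ m, (S.V m : Set K)

/-- The infinite word `ω` corresponds to the point `x`: for every `m`, the cell
`F_{[ω]_m} K` contains `x`. -/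
def IsAddress (ω : ℕ → Fin N) (x : K) : Prop :=
  ∀ m, x ∈ Set.range (S.cellMap (truncate ω m))

/-- `μ` is self-similar with the positive probability weights `p`. -/
structure IsSelfSimilarMeasure [MeasurableSpace K] (p : Fin N → ℝ) (μ : Measure K) : Prop where
  weight_pos : ∀ l, 0 < p l
  weight_sum : ∑ l, p l = 1
  apply_eq : ∀ A : Set K, MeasurableSet A →
    μ A = ∑ l, ENNReal.ofReal (p l) * μ (S.F l ⁻¹' A)

/-- A regular harmonic structure: nonnegative conductances `c` on the complete graph over `V_0`
whose energy vanishes on constants only, and renormalization factors `0 < r_l < 1`, such that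
the energy of level one restricts (by minimization over extensions) to that of level zero. -/
structure HarmonicStructure where
  c : K → K → ℝ
  c_symm : ∀ p ∈ S.V0, ∀ q ∈ S.V0, c p q = c q p
  c_nonneg : ∀ p ∈ S.V0, ∀ q ∈ S.V0, 0 ≤ c p q
  const_of_energy_eq_zero : ∀ f : K → ℝ, energyZero S.V0 c f f = 0 →
    ∀ p ∈ S.V0, ∀ q ∈ S.V0, f p = f q
  r : Fin N → ℝ
  r_pos : ∀ l, 0 < r l
  r_lt_one : ∀ l, r l < 1
  restriction : ∀ f : K → ℝ,
    IsLeast {e : ℝ | ∃ f' : K → ℝ, (∀ q ∈ S.V0, f' q = f q) ∧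
      e = energyLevel S.F S.V0 c r 1 f' f'} (energyZero S.V0 c f f)

end SelfSimilarStructure

namespace SelfSimilarStructure.HarmonicStructure

variable {K : Type*} [MetricSpace K] {N : ℕ} {S : SelfSimilarStructure K N}
  (H : S.HarmonicStructure)

/-- The renormalized energy `E_m` on the graph of level `m`. -/
noncomputable def energy (m : ℕ) (f g : K → ℝ) : ℝ := energyLevel S.F S.V0 H.c H.r m f g

open Classical in
/-- The level-`m` conductance between `x` and `y`: the sum of `r_w⁻¹ c_{pq}` over the
representations `x = F_w p`, `y = F_w q` with `|w| = m` and `p, q ∈ V_0`. It is zero if there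
is none. -/
noncomputable def conductance (m : ℕ) (x y : K) : ℝ :=
  ∑ w : Fin m → Fin N, ∑ p ∈ S.V0, ∑ q ∈ S.V0,
    if S.cellMap w p = x ∧ S.cellMap w q = y then (wordProd H.r w)⁻¹ * H.c p q else 0

/-- The graph Laplacian `Δ_m f (x) = ∑_{y ∼_m x} c_{xy} (f y - f x)`. -/
noncomputable def graphLaplacian (m : ℕ) (f : K → ℝ) (x : K) : ℝ :=
  ∑ y ∈ S.V m, H.conductance m x y * (f y - f x)

/-- Harmonic functions: continuous functions that, for every `m`, minimize the energy of level
`m + 1` among the functions with the same values on `V_m`. -/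
def IsHarmonic (h : K → ℝ) : Prop :=
  Continuous h ∧ ∀ (m : ℕ) (g : K → ℝ), (∀ x ∈ S.V m, g x = h x) →
    H.energy (m + 1) h h ≤ H.energy (m + 1) g g

/-- `ψ` is the tent function of level `m` at `x`: continuous, harmonic on every `m`-cell, with
value `1` at `x` and `0` at the other points of `V_m`. -/
def IsTent (m : ℕ) (x : K) (ψ : K → ℝ) : Prop :=
  Continuous ψ ∧ (∀ w : Fin m → Fin N, H.IsHarmonic (ψ ∘ S.cellMap w)) ∧
    ψ x = 1 ∧ ∀ v ∈ S.V m, v ≠ x → ψ v = 0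

open Classical in
/-- The tent function `ψ_x^m`. -/
noncomputable def tent (m : ℕ) (x : K) : K → ℝ :=
  if h : ∃ ψ : K → ℝ, H.IsTent m x ψ then h.choose else 0

variable [MeasurableSpace K] (μ : Measure K)

/-- The renormalized graph Laplacian `(∫ ψ_x^m dμ)⁻¹ Δ_m f (x)`. -/
noncomputable def renormalizedLaplacian (m : ℕ) (f : K → ℝ) (x : K) : ℝ :=
  (∫ z, H.tent m x z ∂μ)⁻¹ * H.graphLaplacian m f x

/-- `f ∈ dom Δ_μ` and `Δ_μ f = g`: both functions are continuous and the renormalized graph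
Laplacians of `f` converge to `g` uniformly on `V_* \ V_0` (the one of level `m` being defined
at the points of `V_m \ V_0`). -/
def HasLaplacian (f g : K → ℝ) : Prop :=
  Continuous f ∧ Continuous g ∧ ∀ ε > 0, ∃ M : ℕ, ∀ m ≥ M, ∀ x ∈ S.V m, x ∉ S.V0 →
    |H.renormalizedLaplacian μ m f x - g x| < ε

/-- `f ∈ dom (Δ_μ^n)` and `Δ_μ^n f = g`. -/
def HasLaplacianPow : ℕ → (K → ℝ) → (K → ℝ) → Prop
  | 0, f, g => Continuous f ∧ f = g
  | n + 1, f, g => ∃ u : K → ℝ, H.HasLaplacian μ f u ∧ HasLaplacianPow n u g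

/-- `h` is `n`-harmonic: `Δ_μ^n h = 0`. -/
def IsMultiharmonic (n : ℕ) (h : K → ℝ) : Prop := H.HasLaplacianPow μ n h 0

end SelfSimilarStructure.HarmonicStructure

end PCF

/-! ### Words, cells and gluing -/

namespace PCF

/-! The proof is a blow-up argument. Write g = Δ_μ^n f and c = (r_w μ_w)^n. The Laplacian scales
under restriction to a cell, so c⁻¹ f∘F_w has n-th Laplacian g∘F_w, and on a small cell this is
uniformly close to the constant g(x). Take h₁ with Δ_μ^n h₁ = 1 and u with Δ_μ^n u = g∘F_w - g(x).
Then c⁻¹ f∘F_w - g(x) h₁ - u is n-harmonic, hence killed by the functional Σ a_j δ_{y_j}, and c⁻¹ Σ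
a_j f(F_w y_j) = A g(x) + Σ a_j u(y_j). The error is controlled by sup |u|.

Two facts carry this. The scaling law `HasLaplacianPow.comp_cellMap` holds because energies scale by
r_l⁻¹ and integrals of tent functions by μ_l. The solvability of Δ_μ^n u = k with |u| ≤ C sup |k|, C
independent of k (`exists_hasLaplacianPow`), is the main work.

Since r_l < 1, iterating the first-level minimization converges geometrically to a continuous
harmonic extension (`exists_isHarmonic`); this gives piecewise harmonic functions and tents. On the
first level the Poisson equation is a finite-dimensional Dirichlet problem with solution operator P.
The self-similar operator G with (G g)∘F_l = (P g)∘F_l + r_l μ_l G(g∘F_l) then satisfies E_m(G g, v)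
= -∫ v g dμ for piecewise harmonic v vanishing on V_0 (`energy_eq_neg_integral`). Testing with tents
exhibits the renormalized Laplacians of G g at x as averages of g near x, which converge to g
(`hasLaplacian_of_forall_energy`). -/

theorem wordMap_cons {K : Type*} {N : ℕ} (F : Fin N → K → K) (m : ℕ) (l : Fin N)
    (w : Fin m → Fin N) :
    wordMap F (m + 1) (Fin.cons l w) = F l ∘ wordMap F m w := by
  simp [wordMap]

theorem wordProd_cons {N : ℕ} (t : Fin N → ℝ) {m : ℕ} (l : Fin N) (w : Fin m → Fin N) :
    wordProd t (Fin.cons l w : Fin (m + 1) → Fin N) = t l * wordProd t w := by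
  simp [wordProd, Fin.prod_univ_succ]

theorem wordProd_pos {N : ℕ} {t : Fin N → ℝ} (ht : ∀ l, 0 < t l) {m : ℕ} (w : Fin m → Fin N) :
    0 < wordProd t w := Finset.prod_pos fun _ _ => ht _

theorem sum_word_succ {N : ℕ} {M : Type*} [AddCommMonoid M] (m : ℕ)
    (φ : (Fin (m + 1) → Fin N) → M) :
    ∑ w, φ w = ∑ l, ∑ w : Fin m → Fin N, φ (Fin.cons l w) := by
  rw [← (Fin.consEquiv (fun _ : Fin (m + 1) => Fin N)).sum_comp, Fintype.sum_prod_type]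
  rfl

/-- A finite family of reals less than one has a common bound in `(0, 1)`. -/
theorem exists_uniform_bound {ι : Type*} [Finite ι] (t : ι → ℝ) (ht : ∀ i, t i < 1) :
    ∃ ρ, 0 < ρ ∧ ρ < 1 ∧ ∀ i, t i ≤ ρ := by
  have h1 : ∀ᶠ ρ in 𝓝[<] (1 : ℝ), ∀ i, t i ≤ ρ :=
    eventually_all.2 fun i =>
      (eventually_nhdsWithin_of_eventually_nhds (eventually_gt_nhds (ht i))).mono fun _ => le_of_lt
  have h2 : ∀ᶠ ρ in 𝓝[<] (1 : ℝ), 0 < ρ :=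
    eventually_nhdsWithin_of_eventually_nhds (eventually_gt_nhds one_pos)
  obtain ⟨ρ, ⟨h, h0⟩, h3⟩ := ((h1.and h2).and self_mem_nhdsWithin).exists
  exact ⟨ρ, h0, h3, h⟩

theorem energyZero_congr {K : Type*} {V0 : Finset K} {c : K → K → ℝ} {f f' g g' : K → ℝ}
    (hf : ∀ q ∈ V0, f q = f' q) (hg : ∀ q ∈ V0, g q = g' q) :
    energyZero V0 c f g = energyZero V0 c f' g' := by
  unfold energyZero
  congr 1
  refine Finset.sum_congr rfl fun p hp => Finset.sum_congr rfl fun q hq => ?_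
  rw [hf p hp, hf q hq, hg p hp, hg q hq]

namespace SelfSimilarStructure

variable {K : Type*} [MetricSpace K] {N : ℕ} (S : SelfSimilarStructure K N)

theorem cellMap_cons {m : ℕ} (l : Fin N) (w : Fin m → Fin N) (x : K) :
    S.cellMap (Fin.cons l w : Fin (m + 1) → Fin N) x = S.F l (S.cellMap w x) := by
  simp [cellMap, wordMap_cons]

theorem mem_V {m : ℕ} {x : K} :
    x ∈ S.V m ↔ ∃ w : Fin m → Fin N, ∃ q ∈ S.V0, S.cellMap w q = x := by
  simp [V]

theorem V_zero : S.V 0 = S.V0 := by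
  ext x
  simp [mem_V, cellMap, wordMap]

theorem mem_V_succ {m : ℕ} {x : K} : x ∈ S.V (m + 1) ↔ ∃ l, ∃ y ∈ S.V m, S.F l y = x := by
  constructor
  · intro h
    obtain ⟨w, q, hq, rfl⟩ := S.mem_V.1 h
    refine ⟨w 0, S.cellMap (Fin.tail w) q, S.mem_V.2 ⟨_, q, hq, rfl⟩, ?_⟩
    rw [← cellMap_cons, Fin.cons_self_tail]
  · rintro ⟨l, y, hy, rfl⟩
    obtain ⟨w, q, hq, rfl⟩ := S.mem_V.1 hy
    exact S.mem_V.2 ⟨Fin.cons l w, q, hq, S.cellMap_cons l w q⟩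

theorem map_mem_V {m : ℕ} {y : K} (l : Fin N) (hy : y ∈ S.V m) : S.F l y ∈ S.V (m + 1) :=
  S.mem_V_succ.2 ⟨l, y, hy, rfl⟩

theorem V0_subset_V (m : ℕ) {q : K} (hq : q ∈ S.V0) : q ∈ S.V m := by
  induction m with
  | zero => rwa [V_zero]
  | succ m ih =>
    obtain ⟨l, hl⟩ := S.fixed q hq
    exact S.mem_V_succ.2 ⟨l, q, ih, hl⟩

theorem cellMap_mem_V {m : ℕ} (w : Fin m → Fin N) {q : K} (hq : q ∈ S.V0) :
    S.cellMap w q ∈ S.V m := S.mem_V.2 ⟨w, q, hq, rfl⟩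

theorem exists_map_eq (x : K) : ∃ l y, S.F l y = x := by
  have : x ∈ ⋃ l, Set.range (S.F l) := by rw [S.cover]; trivial
  simpa using this

theorem exists_cellMap_eq (m : ℕ) (x : K) : ∃ w : Fin m → Fin N, ∃ y, S.cellMap w y = x := by
  induction m generalizing x with
  | zero => exact ⟨Fin.elim0, x, rfl⟩
  | succ m ih =>
    obtain ⟨l, y, rfl⟩ := S.exists_map_eq x
    obtain ⟨w, z, rfl⟩ := ih y
    exact ⟨Fin.cons l w, z, S.cellMap_cons l w z⟩

theorem continuous_F (l : Fin N) : Continuous (S.F l) := by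
  obtain ⟨κ, h⟩ := S.contracting l
  exact h.2.continuous

theorem continuous_cellMap {m : ℕ} (w : Fin m → Fin N) : Continuous (S.cellMap w) := by
  induction m with
  | zero => exact continuous_id
  | succ m ih => exact (S.continuous_F _).comp (ih (Fin.tail w))

/-- Points of two distinct first-level cells coincide only if they come from the boundary. -/
theorem mem_V0_of_map_eq {l l' : Fin N} (hne : l ≠ l') {x y : K} (h : S.F l x = S.F l' y) :
    x ∈ S.V0 := by
  have hw : (fun _ : Fin 1 => l) ≠ fun _ => l' := fun e => hne (congrFun e 0)
  have hmap : ∀ (l : Fin N) (z : K), wordMap S.F 1 (fun _ => l) z = S.F l z := fun _ _ => rfl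
  have := S.inter_subset 1 _ _ hw ⟨⟨x, hmap l x⟩, ⟨y, (hmap l' y).trans h.symm⟩⟩
  obtain ⟨⟨q, hq, e⟩, -⟩ := this
  rw [hmap] at e
  rw [← S.injective l e]
  exact hq

/-- A boundary point is fixed by some `F l'`. If `F l x` is such a point, then either `l = l'` and
injectivity gives `F l x = x`, or `F l x` lies in two cells and `x` must be a boundary point. -/
theorem map_notMem_V0 (l : Fin N) {x : K} (hx : x ∉ S.V0) : S.F l x ∉ S.V0 := by
  intro h
  obtain ⟨l', hl'⟩ := S.fixed _ h
  by_cases e : l = l'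
  · subst e
    exact hx (S.injective l hl' ▸ h)
  · exact hx (S.mem_V0_of_map_eq e hl'.symm)

/-- The function on `K` with prescribed compositions with the maps `F_l`. -/
noncomputable def glue (φ : Fin N → K → ℝ) (x : K) : ℝ :=
  φ (S.exists_map_eq x).choose (S.exists_map_eq x).choose_spec.choose

/-- Functions on the first-level cells are compatible if they agree at the common points. -/
def Compatible (φ : Fin N → K → ℝ) : Prop :=
  ∀ l l' : Fin N, ∀ p ∈ S.V0, ∀ q ∈ S.V0, S.F l p = S.F l' q → φ l p = φ l' q

variable {S}

/-- A point with preimages under two different maps comes from `V0` on both sides, where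
compatibility applies; so the choice made in `glue` is immaterial. -/
theorem Compatible.glue_apply {φ : Fin N → K → ℝ} (h : S.Compatible φ) (l : Fin N) (y : K) :
    S.glue φ (S.F l y) = φ l y := by
  have key : ∀ l' y', S.F l' y' = S.F l y → φ l' y' = φ l y := by
    intro l' y' e
    by_cases hl : l' = l
    · subst hl
      rw [S.injective _ e]
    · exact h _ _ _ (S.mem_V0_of_map_eq hl e) _ (S.mem_V0_of_map_eq (Ne.symm hl) e.symm) e
  exact key _ _ (S.exists_map_eq (S.F l y)).choose_spec.choose_spec

theorem Compatible.glue_comp {φ : Fin N → K → ℝ} (h : S.Compatible φ) (l : Fin N) :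
    S.glue φ ∘ S.F l = φ l := funext (h.glue_apply l)

variable (S)

theorem compatible_of_eq {φ : Fin N → K → ℝ} (f : K → ℝ)
    (h : ∀ l, ∀ q ∈ S.V0, φ l q = f (S.F l q)) : S.Compatible φ := by
  intro l l' p hp q hq e
  rw [h l p hp, h l' q hq, e]

/-- The first-level cells are finitely many closed sets covering `K`, so closedness of a preimage
may be tested on each of them. -/
theorem continuous_of_comp [CompactSpace K] {f : K → ℝ} (h : ∀ l, Continuous (f ∘ S.F l)) :
    Continuous f := by
  have hemb : ∀ l, IsClosedEmbedding (S.F l) := fun l =>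
    (S.continuous_F l).isClosedEmbedding (S.injective l)
  rw [continuous_iff_isClosed]
  intro s hs
  have : f ⁻¹' s = ⋃ l, S.F l '' ((f ∘ S.F l) ⁻¹' s) := by
    ext x
    simp only [Set.mem_preimage, Set.mem_iUnion, Set.mem_image, Function.comp_apply]
    constructor
    · intro hx
      obtain ⟨l, y, rfl⟩ := S.exists_map_eq x
      exact ⟨l, y, hx, rfl⟩
    · rintro ⟨l, y, hy, rfl⟩
      exact hy
  rw [this]
  exact isClosed_iUnion_of_finite fun l => (hemb l).isClosedMap _ (hs.preimage (h l))

/-- The cells of level `m` are uniformly small. -/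
theorem exists_dist_cellMap_le [CompactSpace K] :
    ∃ κ D : ℝ, 0 < κ ∧ κ < 1 ∧ 0 < D ∧
      (∀ l x y, dist (S.F l x) (S.F l y) ≤ κ * dist x y) ∧
      ∀ (m : ℕ) (w : Fin m → Fin N) (x y : K),
        dist (S.cellMap w x) (S.cellMap w y) ≤ κ ^ m * D := by
  choose k hk using S.contracting
  obtain ⟨κ, h0, h1, h⟩ := exists_uniform_bound (fun l => (k l : ℝ)) fun l => by
    exact_mod_cast (hk l).1
  have hF : ∀ l x y, dist (S.F l x) (S.F l y) ≤ κ * dist x y := fun l x y =>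
    ((hk l).2.dist_le_mul x y).trans (by gcongr; exact h l)
  refine ⟨κ, Metric.diam (Set.univ : Set K) + 1, h0, h1,
    add_pos_of_nonneg_of_pos Metric.diam_nonneg one_pos, hF, ?_⟩
  have hD : ∀ x y : K, dist x y ≤ Metric.diam (Set.univ : Set K) + 1 := fun x y =>
    (Metric.dist_le_diam_of_mem isCompact_univ.isBounded (Set.mem_univ x)
      (Set.mem_univ y)).trans (by linarith)
  intro m
  induction m with
  | zero => intro w x y; simpa [cellMap, wordMap] using hD x y
  | succ m ih =>
    intro w x y
    rw [← Fin.cons_self_tail w, cellMap_cons, cellMap_cons, pow_succ', mul_assoc]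
    exact (hF _ _ _).trans (by gcongr; exact ih _ _ _)

theorem exists_forall_dist_cellMap_lt [CompactSpace K] {ε : ℝ} (hε : 0 < ε) :
    ∃ M, ∀ m ≥ M, ∀ (w : Fin m → Fin N) (x y : K),
      dist (S.cellMap w x) (S.cellMap w y) < ε := by
  obtain ⟨κ, D, h0, h1, hD, -, h⟩ := S.exists_dist_cellMap_le
  have : Tendsto (fun m => κ ^ m * D) atTop (𝓝 0) := by
    simpa using (tendsto_pow_atTop_nhds_zero_of_lt_one h0.le h1).mul_const D
  obtain ⟨M, hM⟩ := eventually_atTop.1 (this.eventually (gt_mem_nhds hε))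
  exact ⟨M, fun m hm w x y => (h m w x y).trans_lt (hM m hm)⟩

/-- The first-level cells form a connected family. -/
theorem eq_of_forall_inter [CompactSpace K] [ConnectedSpace K] {α : Type*} (c : Fin N → α)
    (hc : ∀ l l' x y, S.F l x = S.F l' y → c l = c l') (l l' : Fin N) : c l = c l' := by
  classical
  obtain ⟨x₀⟩ : Nonempty K := inferInstance
  have hcl : ∀ P : Fin N → Prop, IsClosed (⋃ i : {i // P i}, Set.range (S.F i)) := fun P =>
    isClosed_iUnion_of_finite fun i => (isCompact_range (S.continuous_F i)).isClosed
  have hcompl : (⋃ i : {i // c i = c l}, Set.range (S.F i))ᶜ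
      = ⋃ i : {i // c i ≠ c l}, Set.range (S.F i) := by
    ext x
    obtain ⟨i, y, rfl⟩ := S.exists_map_eq x
    simp only [Set.mem_compl_iff, Set.mem_iUnion, Set.mem_range, Subtype.exists, exists_prop]
    constructor
    · intro h
      exact ⟨i, fun e => h ⟨i, e, y, rfl⟩, y, rfl⟩
    · rintro ⟨j, hj, z, hz⟩ ⟨k, hk, t, ht⟩
      exact hj ((hc j k z t (hz.trans ht.symm)).trans hk)
  -- The cells in the class of `l` and the remaining cells have complementary unions, both closed;
  -- connectedness leaves only one class.
  have hclopen : IsClopen (⋃ i : {i // c i = c l}, Set.range (S.F i)) :=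
    ⟨hcl _, by rw [← isClosed_compl_iff, hcompl]; exact hcl _⟩
  have huniv := hclopen.eq_univ ⟨S.F l x₀, Set.mem_iUnion.2 ⟨⟨l, rfl⟩, x₀, rfl⟩⟩
  have : S.F l' x₀ ∈ ⋃ i : {i // c i = c l}, Set.range (S.F i) := huniv ▸ Set.mem_univ _
  obtain ⟨⟨i, hi⟩, z, hz⟩ := Set.mem_iUnion.1 this
  exact hi.symm.trans (hc _ _ _ _ hz)

/-- Without boundary points the first-level cells are disjoint, so connectedness allows only one
map; then `K` is a single cell of every level and its diameter is zero. -/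
theorem V0_nonempty [CompactSpace K] [ConnectedSpace K] [Nontrivial K] : S.V0.Nonempty := by
  by_contra hV
  rw [Finset.not_nonempty_iff_eq_empty] at hV
  have hsub : ∀ l l' : Fin N, l = l' := S.eq_of_forall_inter id fun l l' x y h => by
    by_contra hne
    have := S.mem_V0_of_map_eq hne h
    simp [hV] at this
  obtain ⟨x, y, hxy⟩ := exists_pair_ne K
  refine hxy (dist_le_zero.1 (le_of_forall_pos_lt_add fun ε hε => ?_))
  obtain ⟨M, hM⟩ := S.exists_forall_dist_cellMap_lt hε
  obtain ⟨w, a, rfl⟩ := S.exists_cellMap_eq M x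
  obtain ⟨w', b, rfl⟩ := S.exists_cellMap_eq M y
  obtain rfl : w = w' := funext fun i => hsub _ _
  simpa using hM M le_rfl w a b

theorem dense_Vstar [CompactSpace K] [ConnectedSpace K] [Nontrivial K] : Dense S.Vstar := by
  obtain ⟨q, hq⟩ := S.V0_nonempty
  intro x
  rw [Metric.mem_closure_iff]
  intro ε hε
  obtain ⟨M, hM⟩ := S.exists_forall_dist_cellMap_lt hε
  obtain ⟨w, a, rfl⟩ := S.exists_cellMap_eq M x
  exact ⟨S.cellMap w q, Set.mem_iUnion.2 ⟨M, S.cellMap_mem_V w hq⟩, hM M le_rfl w a q⟩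

end SelfSimilarStructure

/-- A sequence of continuous functions with geometrically small increments converges uniformly. -/
theorem exists_continuous_limit {X : Type*} [TopologicalSpace X] {U : ℕ → X → ℝ} {C ρ : ℝ}
    (hρ0 : 0 < ρ) (hρ : ρ < 1) (hU : ∀ k, Continuous (U k))
    (hC : ∀ k x, |U (k + 1) x - U k x| ≤ C * ρ ^ k) :
    ∃ u : X → ℝ, Continuous u ∧ (∀ x, Tendsto (fun k => U k x) atTop (𝓝 (u x))) ∧
      ∀ x, |u x - U 0 x| ≤ C / (1 - ρ) := by
  have hd : ∀ x k, dist (U k x) (U (k + 1) x) ≤ C * ρ ^ k := fun x k => by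
    rw [dist_comm, Real.dist_eq]
    exact hC k x
  have hlim : ∀ x, ∃ a, Tendsto (fun k => U k x) atTop (𝓝 a) := fun x =>
    cauchySeq_tendsto_of_complete (cauchySeq_of_le_geometric ρ C hρ (hd x))
  choose u hu using hlim
  refine ⟨u, ?_, hu, fun x => ?_⟩
  · have hunif : TendstoUniformly U u atTop := by
      rw [Metric.tendstoUniformly_iff]
      intro ε hε
      have : Tendsto (fun k => C * ρ ^ k / (1 - ρ)) atTop (𝓝 0) := by
        simpa using ((tendsto_pow_atTop_nhds_zero_of_lt_one hρ0.le hρ).const_mul C).div_const (1 - ρ)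
      filter_upwards [this.eventually (gt_mem_nhds hε)] with k hk x
      rw [dist_comm]
      exact (dist_le_of_le_geometric_of_tendsto ρ C hρ (hd x) (hu x) k).trans_lt hk
    exact hunif.continuous (Frequently.of_forall hU)
  · have := dist_le_of_le_geometric_of_tendsto₀ ρ C hρ (hd x) (hu x)
    rwa [dist_comm, Real.dist_eq] at this

/-- A linear functional vanishing on the null space of a positive semidefinite form on a
finite-dimensional space is represented by the form. -/
theorem exists_representer {V : Type*} [AddCommGroup V] [Module ℝ V] [FiniteDimensional ℝ V]
    (B : LinearMap.BilinForm ℝ V) (L : V →ₗ[ℝ] ℝ) (h : ∀ v, B v = 0 → L v = 0) :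
    ∃ u, ∀ v, B v u = L v := by
  have hL : L ∈ (LinearMap.ker B).dualAnnihilator := by
    rw [Submodule.mem_dualAnnihilator]
    intro v hv
    exact h v hv
  -- In finite dimension the annihilator of the kernel is the range of the transpose, so `L` is `ψ ∘
  -- B` with `ψ` in the bidual; by reflexivity `ψ` is evaluation at some `u`.
  rw [← LinearMap.range_dualMap_eq_dualAnnihilator_ker] at hL
  obtain ⟨ψ, hψ⟩ := hL
  obtain ⟨u, rfl⟩ := (Module.evalEquiv ℝ V).surjective ψ
  exact ⟨u, fun v => by rw [← hψ]; simp⟩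

/-! ### Energies, minimizers and the maximum principle -/

namespace SelfSimilarStructure.HarmonicStructure

variable {K : Type*} [MetricSpace K] {N : ℕ} {S : SelfSimilarStructure K N}
  (H : S.HarmonicStructure)

theorem energy_zero (f g : K → ℝ) : H.energy 0 f g = energyZero S.V0 H.c f g := by
  simp [energy, energyLevel, wordProd, wordMap]

theorem energy_succ (m : ℕ) (f g : K → ℝ) :
    H.energy (m + 1) f g = ∑ l, (H.r l)⁻¹ * H.energy m (f ∘ S.F l) (g ∘ S.F l) := by
  unfold energy energyLevel
  rw [sum_word_succ]
  refine Finset.sum_congr rfl fun l _ => ?_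
  rw [Finset.mul_sum]
  refine Finset.sum_congr rfl fun w _ => ?_
  rw [wordProd_cons, wordMap_cons, mul_inv, mul_assoc, Function.comp_assoc, Function.comp_assoc]

theorem energy_congr {m : ℕ} {f f' g g' : K → ℝ} (hf : ∀ x ∈ S.V m, f x = f' x)
    (hg : ∀ x ∈ S.V m, g x = g' x) : H.energy m f g = H.energy m f' g' := by
  unfold energy energyLevel
  refine Finset.sum_congr rfl fun w _ => ?_
  rw [energyZero_congr (f := f ∘ _) (f' := f' ∘ wordMap S.F m w) (g := g ∘ _)
    (g' := g' ∘ wordMap S.F m w) (fun q hq => hf _ (S.cellMap_mem_V w hq))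
    (fun q hq => hg _ (S.cellMap_mem_V w hq))]

theorem energy_comm (m : ℕ) (f g : K → ℝ) : H.energy m f g = H.energy m g f := by
  unfold energy energyLevel energyZero
  refine Finset.sum_congr rfl fun w _ => ?_
  congr 2
  refine Finset.sum_congr rfl fun p _ => Finset.sum_congr rfl fun q _ => ?_
  ring

theorem energy_add_left (m : ℕ) (f f' g : K → ℝ) :
    H.energy m (f + f') g = H.energy m f g + H.energy m f' g := by
  unfold energy energyLevel energyZero
  rw [← Finset.sum_add_distrib]
  refine Finset.sum_congr rfl fun w _ => ?_
  rw [← mul_add, ← mul_add, ← Finset.sum_add_distrib]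
  congr 2
  refine Finset.sum_congr rfl fun p _ => ?_
  rw [← Finset.sum_add_distrib]
  refine Finset.sum_congr rfl fun q _ => ?_
  simp only [Function.comp_apply, Pi.add_apply]
  ring

theorem energy_smul_left (m : ℕ) (t : ℝ) (f g : K → ℝ) :
    H.energy m (t • f) g = t * H.energy m f g := by
  unfold energy energyLevel energyZero
  rw [Finset.mul_sum]
  refine Finset.sum_congr rfl fun w _ => ?_
  rw [mul_left_comm t, mul_left_comm t]
  congr 2
  rw [Finset.mul_sum]
  refine Finset.sum_congr rfl fun p _ => ?_
  rw [Finset.mul_sum]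
  refine Finset.sum_congr rfl fun q _ => ?_
  simp only [Function.comp_apply, Pi.smul_apply, smul_eq_mul]
  ring

/-- The energy of level `m` as a bilinear form. -/
noncomputable def energyForm (m : ℕ) : LinearMap.BilinForm ℝ (K → ℝ) :=
  LinearMap.mk₂ ℝ (fun f g : K → ℝ => H.energy m f g) (H.energy_add_left m) (H.energy_smul_left m)
    (fun f g g' => by simp only [H.energy_comm m f, H.energy_add_left])
    (fun t f g => by simp only [H.energy_comm m f, H.energy_smul_left, smul_eq_mul])

theorem energy_add_right (m : ℕ) (f g g' : K → ℝ) :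
    H.energy m f (g + g') = H.energy m f g + H.energy m f g' := map_add (H.energyForm m f) g g'

theorem energy_smul_right (m : ℕ) (t : ℝ) (f g : K → ℝ) :
    H.energy m f (t • g) = t * H.energy m f g := map_smul (H.energyForm m f) t g

theorem energy_sub_right (m : ℕ) (f g g' : K → ℝ) :
    H.energy m f (g - g') = H.energy m f g - H.energy m f g' := map_sub (H.energyForm m f) g g'

theorem energy_sub_left (m : ℕ) (f f' g : K → ℝ) :
    H.energy m (f - f') g = H.energy m f g - H.energy m f' g := by
  simp only [H.energy_comm m _ g, H.energy_sub_right]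

theorem energy_eq_zero_of_right {m : ℕ} {f g : K → ℝ} (hg : ∀ x ∈ S.V m, g x = 0) :
    H.energy m f g = 0 := by
  rw [H.energy_congr (f' := f) (g' := 0) (fun _ _ => rfl) hg]
  exact map_zero (H.energyForm m f)

theorem energy_nonneg (m : ℕ) (f : K → ℝ) : 0 ≤ H.energy m f f := by
  unfold energy energyLevel energyZero
  refine Finset.sum_nonneg fun w _ => mul_nonneg (inv_nonneg.2 (wordProd_pos H.r_pos w).le) ?_
  refine mul_nonneg (by norm_num) (Finset.sum_nonneg fun p hp => Finset.sum_nonneg fun q hq => ?_)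
  rw [mul_assoc]
  exact mul_nonneg (H.c_nonneg p hp q hq) (mul_self_nonneg _)

/-- Cauchy–Schwarz: the quadratic polynomial t ↦ E(t f + g) is nonnegative, so its discriminant is
not positive. -/
theorem energy_sq_le (m : ℕ) (f g : K → ℝ) :
    H.energy m f g ^ 2 ≤ H.energy m f f * H.energy m g g := by
  have h : ∀ t : ℝ, 0 ≤ H.energy m f f * (t * t) + (2 * H.energy m f g) * t + H.energy m g g := by
    intro t
    have := H.energy_nonneg m (t • f + g)
    simp only [energy_add_left, energy_add_right, energy_smul_left, energy_smul_right] at this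
    rw [H.energy_comm m g f] at this
    linarith
  have := discrim_le_zero h
  unfold discrim at this
  nlinarith

/-- Truncating a function to an interval does not increase its energy. -/
theorem energy_comp_le (m : ℕ) {φ : ℝ → ℝ} (hφ : ∀ s t, |φ s - φ t| ≤ |s - t|) (f : K → ℝ) :
    H.energy m (φ ∘ f) (φ ∘ f) ≤ H.energy m f f := by
  unfold energy energyLevel energyZero
  refine Finset.sum_le_sum fun w _ =>
    mul_le_mul_of_nonneg_left ?_ (inv_nonneg.2 (wordProd_pos H.r_pos w).le)
  refine mul_le_mul_of_nonneg_left (Finset.sum_le_sum fun p hp => Finset.sum_le_sum fun q hq => ?_)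
    (by norm_num)
  rw [mul_assoc, mul_assoc]
  refine mul_le_mul_of_nonneg_left ?_ (H.c_nonneg p hp q hq)
  have := sq_le_sq.2 (hφ (f (wordMap S.F m w p)) (f (wordMap S.F m w q)))
  simpa [sq] using this

theorem energy_zero_le_energy_one (f : K → ℝ) : H.energy 0 f f ≤ H.energy 1 f f := by
  rw [energy_zero]
  exact (H.restriction f).2 ⟨f, fun _ _ => rfl, rfl⟩

theorem energy_le_energy_succ (m : ℕ) (f : K → ℝ) : H.energy m f f ≤ H.energy (m + 1) f f := by
  induction m generalizing f with
  | zero => exact H.energy_zero_le_energy_one f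
  | succ m ih =>
    rw [energy_succ, energy_succ H (m + 1)]
    exact Finset.sum_le_sum fun l _ =>
      mul_le_mul_of_nonneg_left (ih _) (inv_nonneg.2 (H.r_pos l).le)

/-- A minimizer of the first-level energy with prescribed boundary values. -/
noncomputable def ext (f : K → ℝ) : K → ℝ := (H.restriction f).1.choose

theorem ext_eq (f : K → ℝ) {q : K} (hq : q ∈ S.V0) : H.ext f q = f q :=
  (H.restriction f).1.choose_spec.1 q hq

theorem energy_one_ext (f : K → ℝ) : H.energy 1 (H.ext f) (H.ext f) = H.energy 0 f f := by
  rw [energy_zero]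
  exact (H.restriction f).1.choose_spec.2.symm

theorem energy_zero_ext_comp_le (f : K → ℝ) (l : Fin N) :
    H.energy 0 (H.ext f ∘ S.F l) (H.ext f ∘ S.F l) ≤ H.r l * H.energy 0 f f := by
  rw [← H.energy_one_ext f, energy_succ]
  have := Finset.single_le_sum (f := fun l => (H.r l)⁻¹ *
    H.energy 0 (H.ext f ∘ S.F l) (H.ext f ∘ S.F l))
    (fun l _ => mul_nonneg (inv_nonneg.2 (H.r_pos l).le) (H.energy_nonneg 0 _)) (Finset.mem_univ l)
  calc _ = H.r l * ((H.r l)⁻¹ * H.energy 0 (H.ext f ∘ S.F l) (H.ext f ∘ S.F l)) := by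
        rw [mul_inv_cancel_left₀ (H.r_pos l).ne']
    _ ≤ _ := mul_le_mul_of_nonneg_left this (H.r_pos l).le

/-- Every function on `V_m` has an extension to the next level with the same energy. -/
theorem exists_extension_energy_eq (m : ℕ) (f : K → ℝ) :
    ∃ g : K → ℝ, (∀ x ∈ S.V m, g x = f x) ∧ H.energy (m + 1) g g = H.energy m f f := by
  induction m generalizing f with
  | zero =>
    exact ⟨H.ext f, fun x hx => H.ext_eq f (by rwa [S.V_zero] at hx), H.energy_one_ext f⟩
  | succ m ih =>
    choose g hg hE using fun l => ih (f ∘ S.F l)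
    have hcomp : S.Compatible g := S.compatible_of_eq f fun l q hq => hg l q (S.V0_subset_V m hq)
    refine ⟨S.glue g, fun x hx => ?_, ?_⟩
    · obtain ⟨l, y, hy, rfl⟩ := S.mem_V_succ.1 hx
      rw [hcomp.glue_apply, hg l y hy, Function.comp_apply]
    · rw [energy_succ H (m + 1), energy_succ H m]
      simp_rw [hcomp.glue_comp, hE]

/-- The minimum of `E_{m+1}` over extensions from `V_m` is exactly `E_m`, so minimality becomes an
equality of energies without competitors. -/
theorem isHarmonic_iff {h : K → ℝ} :
    H.IsHarmonic h ↔ Continuous h ∧ ∀ m, H.energy (m + 1) h h = H.energy m h h := by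
  refine and_congr_right fun _ => ⟨fun hh m => ?_, fun hh m g hg => ?_⟩
  · obtain ⟨g, hg, hE⟩ := H.exists_extension_energy_eq m h
    exact le_antisymm ((hh m g hg).trans hE.le) (H.energy_le_energy_succ m h)
  · rw [hh m, ← H.energy_congr hg hg]
    exact H.energy_le_energy_succ m g

/-- Both energies are sums over cells with a termwise inequality, so equality of the sums forces
equality in each cell. -/
theorem energy_eq_iff_comp {m : ℕ} {h : K → ℝ} :
    H.energy (m + 2) h h = H.energy (m + 1) h h ↔
      ∀ l, H.energy (m + 1) (h ∘ S.F l) (h ∘ S.F l) = H.energy m (h ∘ S.F l) (h ∘ S.F l) := by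
  rw [energy_succ H (m + 1), energy_succ H m]
  constructor
  · intro e l
    have := (Finset.sum_eq_sum_iff_of_le fun l _ => mul_le_mul_of_nonneg_left
      (H.energy_le_energy_succ m (h ∘ S.F l)) (inv_nonneg.2 (H.r_pos l).le)).1 e.symm l
      (Finset.mem_univ l)
    exact (mul_left_cancel₀ (inv_ne_zero (H.r_pos l).ne') this).symm
  · intro e
    simp_rw [e]

variable {H}

theorem IsHarmonic.continuous {h : K → ℝ} (hh : H.IsHarmonic h) : Continuous h := hh.1

theorem IsHarmonic.comp {h : K → ℝ} (hh : H.IsHarmonic h) (l : Fin N) :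
    H.IsHarmonic (h ∘ S.F l) := by
  rw [isHarmonic_iff] at hh ⊢
  exact ⟨hh.1.comp (S.continuous_F l), fun m => H.energy_eq_iff_comp.1 (hh.2 (m + 1)) l⟩

/-- First variation: `h + t • v` is a competitor for every real `t`, so the term linear in `t` must
vanish. -/
theorem energy_eq_zero_of_minimal {m : ℕ} {h v : K → ℝ}
    (hh : H.energy (m + 1) h h = H.energy m h h) (hv : ∀ x ∈ S.V m, v x = 0) :
    H.energy (m + 1) h v = 0 := by
  have key : ∀ t : ℝ, 0 ≤ 2 * t * H.energy (m + 1) h v + t ^ 2 * H.energy (m + 1) v v := by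
    intro t
    have h1 : H.energy m (h + t • v) (h + t • v) = H.energy m h h :=
      H.energy_congr (fun x hx => by simp [hv x hx]) (fun x hx => by simp [hv x hx])
    have h2 := H.energy_le_energy_succ m (h + t • v)
    rw [h1, ← hh] at h2
    simp only [energy_add_left, energy_add_right, energy_smul_left, energy_smul_right] at h2
    rw [H.energy_comm (m + 1) v h] at h2
    linarith
  have hd := discrim_le_zero (a := H.energy (m + 1) v v) (b := 2 * H.energy (m + 1) h v) (c := 0)
    fun t => by have := key t; nlinarith
  unfold discrim at hd
  nlinarith

/-- Minimality is an orthogonality relation, hence a linear condition. -/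
theorem energy_minimal_iff {m : ℕ} {h : K → ℝ} :
    H.energy (m + 1) h h = H.energy m h h ↔
      ∀ v : K → ℝ, (∀ x ∈ S.V m, v x = 0) → H.energy (m + 1) h v = 0 := by
  refine ⟨fun hh v hv => energy_eq_zero_of_minimal hh hv, fun hh => ?_⟩
  obtain ⟨g, hg, hE⟩ := H.exists_extension_energy_eq m h
  have h0 : ∀ x ∈ S.V m, (h - g) x = 0 := fun x hx => by simp [hg x hx]
  -- Both `h` and the minimal extension `g` are orthogonal to `h - g`, so E(h,h) = E(h,g) = E(g,g).
  have h1 := hh _ h0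
  have h2 : H.energy (m + 1) g (h - g) = 0 :=
    energy_eq_zero_of_minimal (hE.trans (H.energy_congr hg hg).symm) h0
  rw [energy_sub_right, sub_eq_zero] at h1 h2
  rw [h1, H.energy_comm, h2, hE]

theorem IsHarmonic.add {h h' : K → ℝ} (hh : H.IsHarmonic h) (hh' : H.IsHarmonic h') :
    H.IsHarmonic (h + h') := by
  rw [isHarmonic_iff] at *
  refine ⟨hh.1.add hh'.1, fun m => energy_minimal_iff.2 fun v hv => ?_⟩
  rw [energy_add_left, energy_minimal_iff.1 (hh.2 m) v hv, energy_minimal_iff.1 (hh'.2 m) v hv,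
    add_zero]

theorem IsHarmonic.smul {h : K → ℝ} (hh : H.IsHarmonic h) (t : ℝ) : H.IsHarmonic (t • h) := by
  rw [isHarmonic_iff] at *
  refine ⟨hh.1.const_smul t, fun m => energy_minimal_iff.2 fun v hv => ?_⟩
  rw [energy_smul_left, energy_minimal_iff.1 (hh.2 m) v hv, mul_zero]

theorem isHarmonic_zero : H.IsHarmonic 0 := by
  rw [isHarmonic_iff]
  refine ⟨continuous_zero, fun m => ?_⟩
  rw [H.energy_eq_zero_of_right (g := 0) fun _ _ => rfl,
    H.energy_eq_zero_of_right (g := 0) fun _ _ => rfl]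

theorem IsHarmonic.sub {h h' : K → ℝ} (hh : H.IsHarmonic h) (hh' : H.IsHarmonic h') :
    H.IsHarmonic (h - h') := by
  have := hh.add (hh'.smul (-1))
  rwa [neg_one_smul, ← sub_eq_add_neg] at this

/-- The energy of a harmonic function against `v` depends only on the boundary values of `v`. -/
theorem IsHarmonic.energy_eq {h : K → ℝ} (hh : H.IsHarmonic h) (m : ℕ) (v : K → ℝ) :
    H.energy m h v = H.energy 0 h v := by
  induction m with
  | zero => rfl
  | succ m ih =>
    rw [← ih]
    obtain ⟨g, hg, hE⟩ := H.exists_extension_energy_eq m v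
    have hm := (H.isHarmonic_iff.1 hh).2 m
    have h1 : H.energy (m + 1) h v = H.energy (m + 1) h g := by
      have := energy_eq_zero_of_minimal hm (v := v - g) fun x hx => by simp [hg x hx]
      rwa [energy_sub_right, sub_eq_zero] at this
    have hgm : H.energy (m + 1) g g = H.energy m g g := hE.trans (H.energy_congr hg hg).symm
    -- Minimality is linear, so `h + g` keeps its energy too; expanding the squares leaves equality
    -- of the cross terms.
    have h2 : H.energy (m + 1) (h + g) (h + g) = H.energy m (h + g) (h + g) :=
      energy_minimal_iff.2 fun u hu => by
        rw [energy_add_left, energy_eq_zero_of_minimal hm hu, energy_eq_zero_of_minimal hgm hu,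
          add_zero]
    simp only [energy_add_left, energy_add_right] at h2
    rw [H.energy_comm _ g h, H.energy_comm _ g h, hm, hgm] at h2
    rw [h1, H.energy_congr (m := m) (f := h) (f' := h) (g := v) (g' := g) (fun _ _ => rfl)
      fun x hx => (hg x hx).symm]
    linarith

variable [CompactSpace K] [ConnectedSpace K]

/-- The first-level energy is definite on functions vanishing on the boundary. -/
theorem eq_zero_of_energy_one_eq_zero {f : K → ℝ} (h0 : ∀ q ∈ S.V0, f q = 0)
    (hE : H.energy 1 f f = 0) : ∀ x ∈ S.V 1, f x = 0 := by
  rw [energy_succ, Finset.sum_eq_zero_iff_of_nonneg fun l _ =>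
    mul_nonneg (inv_nonneg.2 (H.r_pos l).le) (H.energy_nonneg 0 _)] at hE
  have hconst : ∀ l, ∀ p ∈ S.V0, ∀ q ∈ S.V0, f (S.F l p) = f (S.F l q) := fun l p hp q hq => by
    have h1 := hE l (Finset.mem_univ l)
    rw [mul_eq_zero, inv_eq_zero, or_iff_right (H.r_pos l).ne', energy_zero] at h1
    exact H.const_of_energy_eq_zero _ h1 p hp q hq
  intro x hx
  obtain ⟨l, q, hq, rfl⟩ := S.mem_V_succ.1 hx
  rw [S.V_zero] at hq
  have hc := S.eq_of_forall_inter (fun l => f (S.F l q)) fun l l' a b e => by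
    by_cases hl : l = l'
    · rw [hl]
    · rw [hconst l q hq a (S.mem_V0_of_map_eq hl e), e,
        hconst l' b (S.mem_V0_of_map_eq (Ne.symm hl) e.symm) q hq]
  -- All cells share one constant; the cell whose map fixes `q` contains `q` itself, where `f` is
  -- zero.
  obtain ⟨l', hl'⟩ := S.fixed q hq
  rw [hc l l', hl', h0 q hq]

/-- The difference of two minimizers vanishes on the boundary, so both are orthogonal to it and its
energy is zero. -/
theorem eqOn_V_one_of_minimal {h h' : K → ℝ} (hh : H.energy 1 h h = H.energy 0 h h)
    (hh' : H.energy 1 h' h' = H.energy 0 h' h') (heq : ∀ q ∈ S.V0, h q = h' q) :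
    ∀ x ∈ S.V 1, h x = h' x := by
  have h0 : ∀ q ∈ S.V0, (h - h') q = 0 := fun q hq => by simp [heq q hq]
  have h0' : ∀ q ∈ S.V 0, (h - h') q = 0 := by rwa [S.V_zero]
  have hE : H.energy 1 (h - h') (h - h') = 0 := by
    rw [energy_sub_left, energy_minimal_iff.1 hh _ h0', energy_minimal_iff.1 hh' _ h0', sub_zero]
  intro x hx
  simpa [sub_eq_zero] using eq_zero_of_energy_one_eq_zero h0 hE x hx

/-- Truncation to `[a, b]` keeps the boundary values and does not raise the energy, so it yields
another minimizer; uniqueness identifies the two. -/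
theorem mem_Icc_V_one_of_minimal {h : K → ℝ} (hh : H.energy 1 h h = H.energy 0 h h) {a b : ℝ}
    (hab : ∀ q ∈ S.V0, h q ∈ Set.Icc a b) : ∀ x ∈ S.V 1, h x ∈ Set.Icc a b := by
  intro x hx
  by_cases hle : a ≤ b
  · set φ : ℝ → ℝ := fun t => max a (min b t) with hφ
    have hlip : ∀ s t, |φ s - φ t| ≤ |s - t| := fun s t =>
      (abs_max_sub_max_le_max _ _ _ _).trans (by
        rw [sub_self, abs_zero]
        refine max_le (abs_nonneg _) ((abs_min_sub_min_le_max _ _ _ _).trans ?_)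
        simp)
    have hq : ∀ q ∈ S.V0, (φ ∘ h) q = h q := fun q hq => by
      simp [hφ, (hab q hq).1, (hab q hq).2]
    have hq' : ∀ q ∈ S.V 0, (φ ∘ h) q = h q := by rwa [S.V_zero]
    have hE : H.energy 1 (φ ∘ h) (φ ∘ h) = H.energy 0 (φ ∘ h) (φ ∘ h) := by
      refine le_antisymm ?_ (H.energy_le_energy_succ 0 _)
      rw [H.energy_congr hq' hq', ← hh]
      exact H.energy_comp_le 1 hlip h
    rw [← eqOn_V_one_of_minimal hE hh hq x hx]
    exact ⟨le_max_left _ _, max_le hle (min_le_left _ _)⟩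
  · obtain ⟨l, q, hq, rfl⟩ := S.mem_V_succ.1 hx
    rw [S.V_zero] at hq
    exact absurd ((hab q hq).1.trans (hab q hq).2) hle

/-- The maximum principle on `V_m`. -/
theorem IsHarmonic.mem_Icc_V {h : K → ℝ} (hh : H.IsHarmonic h) {a b : ℝ}
    (hab : ∀ q ∈ S.V0, h q ∈ Set.Icc a b) (m : ℕ) : ∀ x ∈ S.V m, h x ∈ Set.Icc a b := by
  induction m generalizing h with
  | zero => rwa [S.V_zero]
  | succ m ih =>
    intro x hx
    obtain ⟨l, y, hy, rfl⟩ := S.mem_V_succ.1 hx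
    refine ih (hh.comp l) (fun q hq => ?_) y hy
    exact mem_Icc_V_one_of_minimal ((H.isHarmonic_iff.1 hh).2 0) hab _
      (S.map_mem_V l (S.V_zero.symm ▸ hq))

variable [Nontrivial K]

/-- The maximum principle. -/
theorem IsHarmonic.mem_Icc {h : K → ℝ} (hh : H.IsHarmonic h) {a b : ℝ}
    (hab : ∀ q ∈ S.V0, h q ∈ Set.Icc a b) (x : K) : h x ∈ Set.Icc a b := by
  have hcl : IsClosed (h ⁻¹' Set.Icc a b) := isClosed_Icc.preimage hh.continuous
  refine closure_minimal (fun y hy => ?_) hcl (S.dense_Vstar x)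
  obtain ⟨m, hm⟩ := Set.mem_iUnion.1 hy
  exact hh.mem_Icc_V hab m y hm

theorem IsHarmonic.eq_zero {h : K → ℝ} (hh : H.IsHarmonic h) (h0 : ∀ q ∈ S.V0, h q = 0) :
    h = 0 := by
  funext x
  have := hh.mem_Icc (a := 0) (b := 0) (fun q hq => by simp [h0 q hq]) x
  simpa using this

end SelfSimilarStructure.HarmonicStructure

/-! ### Harmonic and piecewise harmonic extensions -/

namespace SelfSimilarStructure.HarmonicStructure

variable {K : Type*} [MetricSpace K] {N : ℕ} {S : SelfSimilarStructure K N}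
  (H : S.HarmonicStructure)

/-- Differences of boundary values are represented by the level-zero energy. -/
theorem exists_difference_representer {p q : K} (hp : p ∈ S.V0) (hq : q ∈ S.V0) :
    ∃ u : K → ℝ, ∀ f : K → ℝ, H.energy 0 f u = f p - f q := by
  -- The level-zero energy sees only values on `V0`, so the problem lives in a finite-dimensional
  -- space, embedded by extension by zero.
  let ι : (S.V0 → ℝ) →ₗ[ℝ] K → ℝ := Function.ExtendByZero.linearMap ℝ Subtype.val
  have hι : ∀ (v : S.V0 → ℝ) (x : S.V0), ι v x = v x := fun v x =>
    Subtype.val_injective.extend_apply v 0 x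
  let L : (S.V0 → ℝ) →ₗ[ℝ] ℝ :=
    LinearMap.proj (R := ℝ) (φ := fun _ : S.V0 => ℝ) ⟨p, hp⟩ -
      LinearMap.proj (R := ℝ) (φ := fun _ : S.V0 => ℝ) ⟨q, hq⟩
  obtain ⟨u, hu⟩ := exists_representer ((H.energyForm 0).compl₁₂ ι ι) L fun v hv => by
    have h0 : H.energy 0 (ι v) (ι v) = 0 := LinearMap.congr_fun hv v
    rw [energy_zero] at h0
    have := H.const_of_energy_eq_zero _ h0 p hp q hq
    rw [hι v ⟨p, hp⟩, hι v ⟨q, hq⟩] at this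
    exact sub_eq_zero.2 this
  refine ⟨ι u, fun f => (H.energy_congr (fun x hx => ?_) fun _ _ => rfl).trans
    (hu fun x => f x)⟩
  rw [S.V_zero] at hx
  exact (hι (fun x => f x) ⟨x, hx⟩).symm

/-- The oscillation of the boundary values is controlled by the energy. -/
theorem exists_oscillation_bound :
    ∃ C : ℝ, 0 ≤ C ∧ ∀ f : K → ℝ, ∀ p ∈ S.V0, ∀ q ∈ S.V0,
      |f p - f q| ≤ C * √(H.energy 0 f f) := by
  choose u hu using fun pq : S.V0 × S.V0 => H.exists_difference_representer pq.1.2 pq.2.2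
  refine ⟨∑ pq, √(H.energy 0 (u pq) (u pq)), Finset.sum_nonneg fun _ _ => Real.sqrt_nonneg _,
    fun f p hp q hq => ?_⟩
  have h1 := H.energy_sq_le 0 f (u (⟨p, hp⟩, ⟨q, hq⟩))
  rw [hu] at h1
  have h2 : √(H.energy 0 (u (⟨p, hp⟩, ⟨q, hq⟩)) (u (⟨p, hp⟩, ⟨q, hq⟩)))
      ≤ ∑ pq, √(H.energy 0 (u pq) (u pq)) :=
    Finset.single_le_sum (f := fun pq => √(H.energy 0 (u pq) (u pq)))
      (fun _ _ => Real.sqrt_nonneg _) (Finset.mem_univ _)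
  calc |f p - f q| ≤ √(H.energy 0 f f *
        H.energy 0 (u (⟨p, hp⟩, ⟨q, hq⟩)) (u (⟨p, hp⟩, ⟨q, hq⟩))) := Real.abs_le_sqrt h1
    _ = √(H.energy 0 (u (⟨p, hp⟩, ⟨q, hq⟩)) (u (⟨p, hp⟩, ⟨q, hq⟩))) * √(H.energy 0 f f) := by
        rw [Real.sqrt_mul (H.energy_nonneg 0 f), mul_comm]
    _ ≤ _ := mul_le_mul_of_nonneg_right h2 (Real.sqrt_nonneg _)

/-- A continuous extension operator from the boundary, with deviations controlled by the
energy. -/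
theorem exists_continuous_extension :
    ∃ (e : (K → ℝ) → K → ℝ) (C : ℝ), 0 ≤ C ∧ ∀ f, Continuous (e f) ∧
      (∀ q ∈ S.V0, e f q = f q) ∧ ∀ x, ∀ q ∈ S.V0, |e f x - f q| ≤ C * √(H.energy 0 f f) := by
  classical
  obtain ⟨C, hC0, hC⟩ := H.exists_oscillation_bound
  have hb : ∀ p : K, ∃ b : C(K, ℝ), Set.EqOn b 0 (S.V0.erase p : Finset K) ∧ Set.EqOn b 1 {p} ∧
      ∀ x, b x ∈ Set.Icc (0 : ℝ) 1 := fun p =>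
    exists_continuous_zero_one_of_isClosed (Finset.isClosed _) isClosed_singleton (by simp)
  choose b hb0 hb1 hb2 using hb
  rcases S.V0.eq_empty_or_nonempty with hV | ⟨p₀, hp₀⟩
  · refine ⟨fun _ => 0, 0, le_rfl, fun f => ⟨continuous_zero, by simp [hV], by simp [hV]⟩⟩
  -- The bumps `b p` need not be a partition of unity: each summand costs one oscillation `C √E`,
  -- and comparing `f p₀` with `f q` costs one more.
  refine ⟨fun f x => f p₀ + ∑ p ∈ S.V0, (f p - f p₀) * b p x, (S.V0.card + 1) * C, by positivity,
    fun f => ⟨by fun_prop, fun q hq => ?_, fun x q hq => ?_⟩⟩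
  · have h0 : ∀ p ∈ S.V0, p ≠ q → (f p - f p₀) * b p q = 0 := fun p _ hpq => by
      rw [hb0 p (x := q) (by simp [hq, Ne.symm hpq]), Pi.zero_apply, mul_zero]
    change f p₀ + ∑ p ∈ S.V0, (f p - f p₀) * b p q = f q
    rw [Finset.sum_eq_single_of_mem q hq h0, hb1 q rfl, Pi.one_apply]
    ring
  · have h1 : |∑ p ∈ S.V0, (f p - f p₀) * b p x| ≤ S.V0.card * (C * √(H.energy 0 f f)) := by
      rw [← nsmul_eq_mul]
      refine (Finset.abs_sum_le_sum_abs _ _).trans (Finset.sum_le_card_nsmul _ _ _ fun p hp => ?_)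
      rw [abs_mul, abs_of_nonneg (hb2 p x).1]
      exact (mul_le_of_le_one_right (abs_nonneg _) (hb2 p x).2).trans (hC f p hp p₀ hp₀)
    have h2 := hC f p₀ hp₀ q hq
    calc |f p₀ + ∑ p ∈ S.V0, (f p - f p₀) * b p x - f q|
        = |(f p₀ - f q) + ∑ p ∈ S.V0, (f p - f p₀) * b p x| := by ring_nf
      _ ≤ _ := (abs_add_le _ _).trans (by linarith)

/-- The successive approximations of the harmonic extension, obtained from an extension
operator `e` by self-similarity. -/
noncomputable def approx (e : (K → ℝ) → K → ℝ) : ℕ → (K → ℝ) → K → ℝ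
  | 0, f => e f
  | k + 1, f => S.glue fun l => approx e k (H.ext f ∘ S.F l)

section

variable {e : (K → ℝ) → K → ℝ}

/-- The two claims are intertwined: gluing at stage k + 1 is legitimate because stage k has the
right boundary values, and these pass to stage k + 1 through the fixed points. -/
theorem approx_eq (he : ∀ f, ∀ q ∈ S.V0, e f q = f q) (k : ℕ) (f : K → ℝ) :
    (∀ q ∈ S.V0, H.approx e k f q = f q) ∧
      ∀ l y, H.approx e (k + 1) f (S.F l y) = H.approx e k (H.ext f ∘ S.F l) y := by
  have hglue : ∀ k, (∀ f, ∀ q ∈ S.V0, H.approx e k f q = f q) → ∀ f l y,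
      H.approx e (k + 1) f (S.F l y) = H.approx e k (H.ext f ∘ S.F l) y := fun k hk f l y =>
    (S.compatible_of_eq (H.ext f) fun l q hq => hk _ q hq).glue_apply l y
  have hb : ∀ k f, ∀ q ∈ S.V0, H.approx e k f q = f q := by
    intro k
    induction k with
    | zero => exact he
    | succ k ih =>
      intro f q hq
      obtain ⟨l, hl⟩ := S.fixed q hq
      conv_lhs => rw [← hl]
      rw [hglue k ih, ih _ q hq, Function.comp_apply, hl, H.ext_eq f hq]
  exact ⟨hb k f, hglue k (hb k) f⟩

theorem continuous_approx [CompactSpace K] (he : ∀ f, ∀ q ∈ S.V0, e f q = f q)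
    (hc : ∀ f, Continuous (e f)) (k : ℕ) (f : K → ℝ) : Continuous (H.approx e k f) := by
  induction k generalizing f with
  | zero => exact hc f
  | succ k ih =>
    refine S.continuous_of_comp fun l => ?_
    rw [show H.approx e (k + 1) f ∘ S.F l = H.approx e k (H.ext f ∘ S.F l) from
      funext ((H.approx_eq he k f).2 l)]
    exact ih _

/-- Passing to the cell `l` multiplies the energy of the boundary data by at most `r l`, hence the
error bound by at most `√(r l) ≤ ρ`. -/
theorem abs_approx_succ_sub_le [CompactSpace K] [ConnectedSpace K] [Nontrivial K]
    (he : ∀ f, ∀ q ∈ S.V0, e f q = f q) {C : ℝ} (hC0 : 0 ≤ C)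
    (hC : ∀ f x, ∀ q ∈ S.V0, |e f x - f q| ≤ C * √(H.energy 0 f f)) {ρ : ℝ} (hρ : 0 ≤ ρ)
    (hr : ∀ l, √(H.r l) ≤ ρ) (k : ℕ) (f : K → ℝ) (x : K) :
    |H.approx e (k + 1) f x - H.approx e k f x| ≤ 3 * C * √(H.energy 0 f f) * ρ ^ k := by
  have hdecay : ∀ f l, √(H.energy 0 (H.ext f ∘ S.F l) (H.ext f ∘ S.F l))
      ≤ √(H.r l) * √(H.energy 0 f f) := fun f l => by
    rw [← Real.sqrt_mul (H.r_pos l).le]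
    exact Real.sqrt_le_sqrt (H.energy_zero_ext_comp_le f l)
  induction k generalizing f x with
  | zero =>
    obtain ⟨q, hq⟩ := S.V0_nonempty
    obtain ⟨l, y, rfl⟩ := S.exists_map_eq x
    rw [(H.approx_eq he 0 f).2, pow_zero, mul_one]
    change |e (H.ext f ∘ S.F l) y - e f (S.F l y)| ≤ _
    -- The factor 3 comes from the path through `H.ext f (S.F l q)` and `f q`; the middle distance
    -- is bounded by the maximum principle.
    have h1 := hC (H.ext f ∘ S.F l) y q hq
    have h2 := hC f (S.F l y) q hq
    have h3 : |H.ext f (S.F l q) - f q| ≤ C * √(H.energy 0 f f) := by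
      rw [abs_le, neg_le_sub_iff_le_add, sub_le_iff_le_add, ← sub_le_iff_le_add]
      refine mem_Icc_V_one_of_minimal (H := H) (a := f q - C * √(H.energy 0 f f)) ?_
        (fun p hp => ?_) _ (S.map_mem_V l (S.V_zero.symm ▸ hq))
      · rw [energy_one_ext]
        refine H.energy_congr ?_ ?_ <;>
        · rw [S.V_zero]
          exact fun p hp => (H.ext_eq f hp).symm
      · have := abs_le.1 (he f p hp ▸ hC f p q hq)
        rw [H.ext_eq f hp]
        constructor <;> linarith
    have h4 : C * √(H.energy 0 (H.ext f ∘ S.F l) (H.ext f ∘ S.F l)) ≤ C * √(H.energy 0 f f) :=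
      mul_le_mul_of_nonneg_left ((hdecay f l).trans (mul_le_of_le_one_left (Real.sqrt_nonneg _)
        (Real.sqrt_le_one.2 (H.r_lt_one l).le))) hC0
    rw [Function.comp_apply] at h1
    rw [abs_le] at *
    constructor <;> linarith
  | succ k ih =>
    obtain ⟨l, y, rfl⟩ := S.exists_map_eq x
    rw [(H.approx_eq he (k + 1) f).2, (H.approx_eq he k f).2]
    refine (ih _ y).trans ?_
    have : √(H.energy 0 (H.ext f ∘ S.F l) (H.ext f ∘ S.F l)) ≤ ρ * √(H.energy 0 f f) :=
      (hdecay f l).trans (mul_le_mul_of_nonneg_right (hr l) (Real.sqrt_nonneg _))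
    calc _ ≤ 3 * C * (ρ * √(H.energy 0 f f)) * ρ ^ k := by gcongr
      _ = _ := by ring

end

/-- Continuous functions that are harmonic on every cell of level `m`. -/
def IsPiecewiseHarmonic (m : ℕ) (v : K → ℝ) : Prop :=
  Continuous v ∧ ∀ w : Fin m → Fin N, H.IsHarmonic (v ∘ S.cellMap w)

variable {H}

theorem isPiecewiseHarmonic_succ [CompactSpace K] {m : ℕ} {v : K → ℝ} :
    H.IsPiecewiseHarmonic (m + 1) v ↔ ∀ l, H.IsPiecewiseHarmonic m (v ∘ S.F l) := by
  have hcomp : ∀ l (w : Fin m → Fin N), v ∘ S.cellMap (Fin.cons l w : Fin (m + 1) → Fin N) =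
      (v ∘ S.F l) ∘ S.cellMap w := fun l w => funext fun x =>
    congrArg v (S.cellMap_cons l w x)
  constructor
  · intro h l
    exact ⟨h.1.comp (S.continuous_F l), fun w => hcomp l w ▸ h.2 (Fin.cons l w)⟩
  · intro h
    refine ⟨S.continuous_of_comp fun l => (h l).1, fun w => ?_⟩
    rw [← Fin.cons_self_tail w, hcomp]
    exact (h _).2 _

theorem isPiecewiseHarmonic_zero {v : K → ℝ} : H.IsPiecewiseHarmonic 0 v ↔ H.IsHarmonic v :=
  ⟨fun h => h.2 Fin.elim0, fun h => ⟨h.1, fun _ => h⟩⟩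

theorem IsPiecewiseHarmonic.add {m : ℕ} {v v' : K → ℝ} (h : H.IsPiecewiseHarmonic m v)
    (h' : H.IsPiecewiseHarmonic m v') : H.IsPiecewiseHarmonic m (v + v') :=
  ⟨h.1.add h'.1, fun w => (h.2 w).add (h'.2 w)⟩

theorem IsPiecewiseHarmonic.smul {m : ℕ} {v : K → ℝ} (h : H.IsPiecewiseHarmonic m v) (t : ℝ) :
    H.IsPiecewiseHarmonic m (t • v) :=
  ⟨h.1.const_smul t, fun w => (h.2 w).smul t⟩

theorem IsPiecewiseHarmonic.sub {m : ℕ} {v v' : K → ℝ} (h : H.IsPiecewiseHarmonic m v)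
    (h' : H.IsPiecewiseHarmonic m v') : H.IsPiecewiseHarmonic m (v - v') :=
  ⟨h.1.sub h'.1, fun w => (h.2 w).sub (h'.2 w)⟩

theorem isPiecewiseHarmonic_const_zero (m : ℕ) : H.IsPiecewiseHarmonic m 0 :=
  ⟨continuous_zero, fun _ => isHarmonic_zero⟩

theorem IsHarmonic.isPiecewiseHarmonic [CompactSpace K] {h : K → ℝ} (hh : H.IsHarmonic h) (m : ℕ) :
    H.IsPiecewiseHarmonic m h := by
  induction m generalizing h with
  | zero => exact isPiecewiseHarmonic_zero.2 hh
  | succ m ih => exact isPiecewiseHarmonic_succ.2 fun l => ih (hh.comp l)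

variable (H)

/-- The functions that are harmonic on the first-level cells and vanish on the boundary. -/
def dirichletSpace : Submodule ℝ (K → ℝ) where
  carrier := {v | H.IsPiecewiseHarmonic 1 v ∧ ∀ q ∈ S.V0, v q = 0}
  add_mem' h h' := ⟨h.1.add h'.1, fun q hq => by simp [h.2 q hq, h'.2 q hq]⟩
  zero_mem' := ⟨isPiecewiseHarmonic_const_zero 1, fun _ _ => rfl⟩
  smul_mem' t _ h := ⟨h.1.smul t, fun q hq => by simp [h.2 q hq]⟩

variable [CompactSpace K] [ConnectedSpace K] [Nontrivial K]

/-- Every function on the boundary has a harmonic extension. -/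
theorem exists_isHarmonic (f : K → ℝ) :
    ∃ h : K → ℝ, H.IsHarmonic h ∧ ∀ q ∈ S.V0, h q = f q := by
  obtain ⟨e, C, hC0, he⟩ := H.exists_continuous_extension
  obtain ⟨ρ, hρ0, hρ1, hρ⟩ := exists_uniform_bound (fun l => √(H.r l)) fun l =>
    by
      rw [Real.sqrt_lt' one_pos, one_pow]
      exact H.r_lt_one l
  have hq := fun f => (he f).2.1
  choose h hcont hlim _ using fun f => exists_continuous_limit hρ0 hρ1
    (H.continuous_approx hq (fun f => (he f).1) · f)
    (H.abs_approx_succ_sub_le hq hC0 (fun f => (he f).2.2) hρ0.le hρ · f)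
  have hbd : ∀ f, ∀ q ∈ S.V0, h f q = f q := fun f q hq' =>
    tendsto_nhds_unique (hlim f q) (by simp only [(H.approx_eq hq _ f).1 q hq', tendsto_const_nhds])
  -- Self-similarity passes to the limit after an index shift; it reduces minimality at every level
  -- to level zero.
  have hself : ∀ f l, h f ∘ S.F l = h (H.ext f ∘ S.F l) := fun f l => funext fun y => by
    refine tendsto_nhds_unique ((tendsto_add_atTop_iff_nat 1).2 (hlim f (S.F l y))) ?_
    simp only [(H.approx_eq hq _ f).2]
    exact hlim _ y
  refine ⟨h f, H.isHarmonic_iff.2 ⟨hcont f, fun m => ?_⟩, hbd f⟩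
  induction m generalizing f with
  | zero =>
    have h0 : ∀ q ∈ S.V 0, h f q = f q := S.V_zero.symm ▸ hbd f
    have h1 : ∀ x ∈ S.V 1, h f x = H.ext f x := fun x hx => by
      obtain ⟨l, q, hq', rfl⟩ := S.mem_V_succ.1 hx
      rw [S.V_zero] at hq'
      exact (congrFun (hself f l) q).trans (hbd _ q hq')
    rw [H.energy_congr h0 h0, ← H.energy_one_ext f]
    exact H.energy_congr h1 h1
  | succ m ih =>
    refine H.energy_eq_iff_comp.2 fun l => ?_
    rw [hself]
    exact ih _

variable {H}

theorem IsPiecewiseHarmonic.mem_Icc {m : ℕ} {v : K → ℝ} (h : H.IsPiecewiseHarmonic m v) {a b : ℝ}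
    (hab : ∀ x ∈ S.V m, v x ∈ Set.Icc a b) (x : K) : v x ∈ Set.Icc a b := by
  obtain ⟨w, y, rfl⟩ := S.exists_cellMap_eq m x
  exact (h.2 w).mem_Icc (fun q hq => hab _ (S.cellMap_mem_V w hq)) y

theorem IsPiecewiseHarmonic.eq_zero {m : ℕ} {v : K → ℝ} (h : H.IsPiecewiseHarmonic m v)
    (h0 : ∀ x ∈ S.V m, v x = 0) : v = 0 := by
  funext x
  have := h.mem_Icc (a := 0) (b := 0) (fun q hq => by simp [h0 q hq]) x
  simpa using this

theorem IsPiecewiseHarmonic.ext {m : ℕ} {v v' : K → ℝ} (h : H.IsPiecewiseHarmonic m v)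
    (h' : H.IsPiecewiseHarmonic m v') (heq : ∀ x ∈ S.V m, v x = v' x) : v = v' :=
  sub_eq_zero.1 ((h.sub h').eq_zero fun x hx => by simp [heq x hx])

variable (H)

/-- Functions on `V_m` have piecewise harmonic extensions. -/
theorem exists_isPiecewiseHarmonic (m : ℕ) (f : K → ℝ) :
    ∃ v : K → ℝ, H.IsPiecewiseHarmonic m v ∧ ∀ x ∈ S.V m, v x = f x := by
  induction m generalizing f with
  | zero =>
    obtain ⟨h, hh, hb⟩ := H.exists_isHarmonic f
    exact ⟨h, isPiecewiseHarmonic_zero.2 hh, S.V_zero.symm ▸ hb⟩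
  | succ m ih =>
    choose v hv hb using fun l => ih (f ∘ S.F l)
    have hcomp : S.Compatible v := S.compatible_of_eq f fun l q hq => hb l q (S.V0_subset_V m hq)
    refine ⟨S.glue v, isPiecewiseHarmonic_succ.2 fun l => ?_, fun x hx => ?_⟩
    · rw [hcomp.glue_comp]
      exact hv l
    · obtain ⟨l, y, hy, rfl⟩ := S.mem_V_succ.1 hx
      rw [hcomp.glue_apply, hb l y hy, Function.comp_apply]

/-- By the maximum principle the elements are determined by their values on the finite set `V 1`. -/
instance : FiniteDimensional ℝ H.dirichletSpace := by
  let R : H.dirichletSpace →ₗ[ℝ] (S.V 1 → ℝ) :=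
    (LinearMap.funLeft ℝ ℝ Subtype.val).comp H.dirichletSpace.subtype
  refine Module.Finite.of_injective R ((injective_iff_map_eq_zero R).2 fun v hv => ?_)
  exact Subtype.ext (v.2.1.eq_zero fun x hx => congrFun hv ⟨x, hx⟩)

/-- The first-level energy is definite on this space. Point evaluations and integration against `g`
are the functionals to be represented. -/
theorem exists_dirichlet_representer (L : H.dirichletSpace →ₗ[ℝ] ℝ) :
    ∃ u ∈ H.dirichletSpace, ∀ v : H.dirichletSpace, H.energy 1 v u = L v := by
  obtain ⟨u, hu⟩ := exists_representer
    ((H.energyForm 1).compl₁₂ H.dirichletSpace.subtype H.dirichletSpace.subtype) L fun v hv => by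
      have h0 : H.energy 1 (v : K → ℝ) v = 0 := LinearMap.congr_fun hv v
      have : v = 0 := Subtype.ext (v.2.1.eq_zero (eq_zero_of_energy_one_eq_zero v.2.2 h0))
      rw [this, map_zero]
  exact ⟨u, u.2, hu⟩

end SelfSimilarStructure.HarmonicStructure

/-! ### Self-similar measures -/

theorem _root_.Continuous.integrable_of_compactSpace {X : Type*} [TopologicalSpace X]
    [CompactSpace X] [MeasurableSpace X] [BorelSpace X] {μ : Measure X} [IsFiniteMeasure μ]
    {f : X → ℝ} (hf : Continuous f) : Integrable f μ :=
  hf.integrable_of_hasCompactSupport (HasCompactSupport.of_compactSpace f)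

namespace SelfSimilarStructure

variable {K : Type*} [MetricSpace K] [MeasurableSpace K] {N : ℕ}
  {S : SelfSimilarStructure K N} {p : Fin N → ℝ} {μ : Measure K}

theorem IsSelfSimilarMeasure.weight_le_one (hμ : S.IsSelfSimilarMeasure p μ) (l : Fin N) :
    p l ≤ 1 := by
  rw [← hμ.weight_sum]
  exact Finset.single_le_sum (fun l _ => (hμ.weight_pos l).le) (Finset.mem_univ l)

variable [BorelSpace K]

theorem IsSelfSimilarMeasure.eq_sum (hμ : S.IsSelfSimilarMeasure p μ) :
    μ = ∑ l, ENNReal.ofReal (p l) • μ.map (S.F l) := by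
  ext A hA
  rw [hμ.apply_eq A hA, Measure.finsetSum_apply]
  refine Finset.sum_congr rfl fun l _ => ?_
  rw [Measure.smul_apply, Measure.map_apply (S.continuous_F l).measurable hA, smul_eq_mul]

variable [CompactSpace K]

/-- The self-similar identity for integrals. -/
theorem IsSelfSimilarMeasure.integral_eq [IsFiniteMeasure μ] (hμ : S.IsSelfSimilarMeasure p μ)
    {φ : K → ℝ} (hφ : Continuous φ) : ∫ x, φ x ∂μ = ∑ l, p l * ∫ x, φ (S.F l x) ∂μ := by
  conv_lhs => rw [hμ.eq_sum]
  rw [integral_finsetSum_measure fun l _ =>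
    (hφ.integrable_of_compactSpace).smul_measure ENNReal.ofReal_ne_top]
  refine Finset.sum_congr rfl fun l _ => ?_
  rw [integral_smul_measure, ENNReal.toReal_ofReal (hμ.weight_pos l).le, smul_eq_mul,
    integral_map (S.continuous_F l).measurable.aemeasurable hφ.aestronglyMeasurable]

/-- Keeping only the term of the first letter in the self-similar identity gives μ(F_w K) ≥ p_{w_1}
μ(F_{w_2⋯w_m} K). Possible overlaps of cells do no harm. -/
theorem IsSelfSimilarMeasure.measure_cell_pos [IsProbabilityMeasure μ]
    (hμ : S.IsSelfSimilarMeasure p μ) {m : ℕ} (w : Fin m → Fin N) :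
    0 < μ (Set.range (S.cellMap w)) := by
  induction m with
  | zero =>
    have : Set.range (S.cellMap w) = Set.univ := Set.range_id
    rw [this, measure_univ]
    exact one_pos
  | succ m ih =>
    have hmeas : MeasurableSet (Set.range (S.cellMap w)) :=
      (isCompact_range (S.continuous_cellMap w)).isClosed.measurableSet
    have hsub : Set.range (S.cellMap (Fin.tail w)) ⊆ S.F (w 0) ⁻¹' Set.range (S.cellMap w) := by
      rintro _ ⟨x, rfl⟩
      exact ⟨x, rfl⟩
    rw [hμ.apply_eq _ hmeas]
    refine lt_of_lt_of_le ?_ (Finset.single_le_sum (f := fun l => ENNReal.ofReal (p l) *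
      μ (S.F l ⁻¹' Set.range (S.cellMap w))) (fun _ _ => zero_le) (Finset.mem_univ (w 0)))
    exact ENNReal.mul_pos (ENNReal.ofReal_pos.2 (hμ.weight_pos _)).ne'
      ((ih (Fin.tail w)).trans_le (measure_mono hsub)).ne'

/-- A self-similar measure charges every nonempty open set. -/
theorem IsSelfSimilarMeasure.isOpenPosMeasure [IsProbabilityMeasure μ]
    (hμ : S.IsSelfSimilarMeasure p μ) : μ.IsOpenPosMeasure := by
  refine ⟨fun U hU ⟨x, hx⟩ => ?_⟩
  obtain ⟨ε, hε, hball⟩ := Metric.isOpen_iff.1 hU x hx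
  obtain ⟨M, hM⟩ := S.exists_forall_dist_cellMap_lt hε
  obtain ⟨w, y, rfl⟩ := S.exists_cellMap_eq M x
  refine ((hμ.measure_cell_pos w).trans_le (measure_mono ?_)).ne'
  rintro _ ⟨z, rfl⟩
  exact hball (hM M le_rfl w z y)

end SelfSimilarStructure

/-! ### Graph Laplacians, tent functions and scaling -/

namespace SelfSimilarStructure.HarmonicStructure

variable {K : Type*} [MetricSpace K] {N : ℕ} {S : SelfSimilarStructure K N}
  (H : S.HarmonicStructure)

open Classical in
/-- The graph Laplacian at `x` is the energy against the indicator function of `x`. -/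
theorem graphLaplacian_eq (m : ℕ) (f : K → ℝ) (x : K) :
    H.graphLaplacian m f x = -H.energy m f (Pi.single x 1) := by
  have hswap : ∀ φ : (Fin m → Fin N) → K → K → K → ℝ,
      ∑ y ∈ S.V m, ∑ w, ∑ p ∈ S.V0, ∑ q ∈ S.V0, φ w p q y =
        ∑ w, ∑ p ∈ S.V0, ∑ q ∈ S.V0, ∑ y ∈ S.V m, φ w p q y := fun φ => by
    rw [Finset.sum_comm]
    refine Finset.sum_congr rfl fun w _ => ?_
    rw [Finset.sum_comm]
    refine Finset.sum_congr rfl fun p _ => ?_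
    rw [Finset.sum_comm]
  unfold graphLaplacian conductance energy energyLevel energyZero
  simp_rw [Finset.sum_mul]
  rw [hswap, ← Finset.sum_neg_distrib]
  refine Finset.sum_congr rfl fun w _ => ?_
  set δ : K → ℝ := Pi.single x 1 with hδ
  set a : K → K → ℝ := fun p q =>
    H.c p q * (f (wordMap S.F m w p) - f (wordMap S.F m w q)) * δ (wordMap S.F m w p) with ha
  -- By symmetry of `c` the two endpoints of an edge contribute equally, which cancels the factor
  -- 1/2 in the energy.
  have hsymm : ∑ p ∈ S.V0, ∑ q ∈ S.V0, H.c p q *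
      ((f ∘ wordMap S.F m w) p - (f ∘ wordMap S.F m w) q) *
      ((δ ∘ wordMap S.F m w) p - (δ ∘ wordMap S.F m w) q) = 2 * ∑ p ∈ S.V0, ∑ q ∈ S.V0, a p q := by
    have h1 : ∑ p ∈ S.V0, ∑ q ∈ S.V0, a q p = ∑ p ∈ S.V0, ∑ q ∈ S.V0, a p q := Finset.sum_comm
    rw [two_mul]
    conv_rhs => rw [← h1]
    nth_rw 2 [h1]
    rw [← Finset.sum_add_distrib]
    refine Finset.sum_congr rfl fun p hp => ?_
    rw [← Finset.sum_add_distrib]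
    refine Finset.sum_congr rfl fun q hq => ?_
    simp only [ha, Function.comp_apply, H.c_symm q hq p hp]
    ring
  rw [hsymm, ← mul_assoc (1 / 2 : ℝ), one_div, inv_mul_cancel₀ two_ne_zero, one_mul,
    Finset.mul_sum, ← Finset.sum_neg_distrib]
  refine Finset.sum_congr rfl fun p hp => ?_
  rw [Finset.mul_sum, ← Finset.sum_neg_distrib]
  refine Finset.sum_congr rfl fun q hq => ?_
  rw [Finset.sum_eq_single_of_mem _ (S.cellMap_mem_V w hq) fun y _ hy => by
    rw [if_neg fun h => hy h.2.symm, zero_mul]]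
  change _ = -((wordProd H.r w)⁻¹ * (H.c p q * (f (S.cellMap w p) - f (S.cellMap w q)) *
    δ (S.cellMap w p)))
  by_cases hx : S.cellMap w p = x
  · rw [if_pos ⟨hx, rfl⟩, hx, hδ, Pi.single_eq_same]
    ring
  · rw [if_neg fun h => hx h.1, hδ, Pi.single_eq_of_ne hx]
    ring

theorem graphLaplacian_eq_of_forall {m : ℕ} {f v : K → ℝ} {x : K} (hx : v x = 1)
    (hv : ∀ y ∈ S.V m, y ≠ x → v y = 0) : H.graphLaplacian m f x = -H.energy m f v := by
  classical
  rw [graphLaplacian_eq, H.energy_congr (fun _ _ => rfl) fun y hy => ?_]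
  by_cases h : y = x
  · rw [h, hx, Pi.single_eq_same]
  · rw [hv y hy h, Pi.single_eq_of_ne h]

theorem graphLaplacian_add_smul (m : ℕ) (f f' : K → ℝ) (t : ℝ) (x : K) :
    H.graphLaplacian m (f + t • f') x = H.graphLaplacian m f x + t * H.graphLaplacian m f' x := by
  classical
  simp only [graphLaplacian_eq, energy_add_left, energy_smul_left]
  ring

/-- For `x` off the boundary, `S.F l x` lies in no other first-level cell, so only the summand of
`l` in `energy_succ` survives. -/
theorem graphLaplacian_succ_map (m : ℕ) (f : K → ℝ) (l : Fin N) {x : K} (hx : x ∉ S.V0) :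
    H.graphLaplacian (m + 1) f (S.F l x) = (H.r l)⁻¹ * H.graphLaplacian m (f ∘ S.F l) x := by
  classical
  rw [graphLaplacian_eq, graphLaplacian_eq, energy_succ, Finset.sum_eq_single l, mul_neg]
  · congr 3
    funext y
    by_cases h : y = x
    · simp [h]
    · rw [Function.comp_apply, Pi.single_eq_of_ne h,
        Pi.single_eq_of_ne fun e => h (S.injective l e)]
  · intro l' _ hne
    rw [H.energy_eq_zero_of_right fun y _ => ?_, mul_zero]
    rw [Function.comp_apply, Pi.single_eq_of_ne]
    exact fun e => hx (S.mem_V0_of_map_eq (Ne.symm hne) e.symm)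
  · exact fun h => absurd (Finset.mem_univ l) h

variable {H}

theorem isTent_iff {m : ℕ} {x : K} {ψ : K → ℝ} :
    H.IsTent m x ψ ↔ H.IsPiecewiseHarmonic m ψ ∧ ψ x = 1 ∧ ∀ v ∈ S.V m, v ≠ x → ψ v = 0 := by
  unfold IsTent IsPiecewiseHarmonic
  tauto

section

variable [MeasurableSpace K] {μ : Measure K}

theorem HasLaplacian.add_smul {f g f' g' : K → ℝ} (h : H.HasLaplacian μ f g)
    (h' : H.HasLaplacian μ f' g') (t : ℝ) : H.HasLaplacian μ (f + t • f') (g + t • g') := by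
  refine ⟨h.1.add (h'.1.const_smul t), h.2.1.add (h'.2.1.const_smul t), fun ε hε => ?_⟩
  have hε' : 0 < ε / 2 / (|t| + 1) := by positivity
  obtain ⟨M, hM⟩ := h.2.2 (ε / 2) (half_pos hε)
  obtain ⟨M', hM'⟩ := h'.2.2 _ hε'
  refine ⟨max M M', fun m hm x hx hx0 => ?_⟩
  have h1 := hM m (le_of_max_le_left hm) x hx hx0
  have h2 := hM' m (le_of_max_le_right hm) x hx hx0
  have h3 : |t| * |H.renormalizedLaplacian μ m f' x - g' x| ≤ ε / 2 := by
    calc _ ≤ (|t| + 1) * (ε / 2 / (|t| + 1)) :=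
          mul_le_mul (by linarith) h2.le (abs_nonneg _) (by positivity)
      _ = ε / 2 := by field_simp
  rw [← abs_mul] at h3
  calc _ = |(H.renormalizedLaplacian μ m f x - g x) +
        t * (H.renormalizedLaplacian μ m f' x - g' x)| := by
        simp only [renormalizedLaplacian, graphLaplacian_add_smul, Pi.add_apply, Pi.smul_apply,
          smul_eq_mul]
        ring_nf
    _ < ε := (abs_add_le _ _).trans_lt (by linarith)

theorem hasLaplacian_zero : H.HasLaplacian μ 0 0 :=
  ⟨continuous_zero, continuous_zero, fun ε hε => ⟨0, fun m _ x _ _ => by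
    simpa [renormalizedLaplacian, graphLaplacian] using hε⟩⟩

theorem hasLaplacianPow_zero (n : ℕ) : H.HasLaplacianPow μ n 0 0 := by
  induction n with
  | zero => exact ⟨continuous_zero, rfl⟩
  | succ n ih => exact ⟨0, hasLaplacian_zero, ih⟩

theorem HasLaplacianPow.add_smul {n : ℕ} {f g f' g' : K → ℝ} (h : H.HasLaplacianPow μ n f g)
    (h' : H.HasLaplacianPow μ n f' g') (t : ℝ) :
    H.HasLaplacianPow μ n (f + t • f') (g + t • g') := by
  induction n generalizing f f' with
  | zero => exact ⟨h.1.add (h'.1.const_smul t), by rw [h.2, h'.2]⟩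
  | succ n ih =>
    obtain ⟨u, h1, h2⟩ := h
    obtain ⟨u', h1', h2'⟩ := h'
    exact ⟨u + t • u', h1.add_smul h1' t, ih h2 h2'⟩

theorem HasLaplacianPow.smul {n : ℕ} {f g : K → ℝ} (h : H.HasLaplacianPow μ n f g) (t : ℝ) :
    H.HasLaplacianPow μ n (t • f) (t • g) := by
  simpa using (hasLaplacianPow_zero n).add_smul h t

theorem HasLaplacianPow.continuous_right {n : ℕ} {f g : K → ℝ} (h : H.HasLaplacianPow μ n f g) :
    Continuous g := by
  induction n generalizing f with
  | zero => exact h.2 ▸ h.1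
  | succ n ih =>
    obtain ⟨u, -, h2⟩ := h
    exact ih h2

end

variable [CompactSpace K] [ConnectedSpace K] [Nontrivial K]

theorem IsTent.unique {m : ℕ} {x : K} {ψ ψ' : K → ℝ} (h : H.IsTent m x ψ) (h' : H.IsTent m x ψ') :
    ψ = ψ' := by
  rw [isTent_iff] at h h'
  refine h.1.ext h'.1 fun y hy => ?_
  by_cases e : y = x
  · rw [e, h.2.1, h'.2.1]
  · rw [h.2.2 y hy e, h'.2.2 y hy e]

variable (H)

theorem isTent_tent {m : ℕ} {x : K} (hx : x ∈ S.V m) : H.IsTent m x (H.tent m x) := by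
  classical
  have hex : ∃ ψ : K → ℝ, H.IsTent m x ψ := by
    obtain ⟨v, hv, hb⟩ := H.exists_isPiecewiseHarmonic m (Pi.single x 1)
    refine ⟨v, isTent_iff.2 ⟨hv, ?_, fun y hy hne => ?_⟩⟩
    · rw [hb x hx, Pi.single_eq_same]
    · rw [hb y hy, Pi.single_eq_of_ne hne]
  rw [tent, dif_pos hex]
  exact hex.choose_spec

/-- Piecewise harmonic functions are determined by their vertex values; those of the larger tent are
a tent in the cell `l` and zero in the others. -/
theorem tent_succ_map_comp (m : ℕ) (l : Fin N) {x : K} (hx : x ∈ S.V m) (hx0 : x ∉ S.V0) :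
    H.tent (m + 1) (S.F l x) ∘ S.F l = H.tent m x ∧
      ∀ l', l' ≠ l → H.tent (m + 1) (S.F l x) ∘ S.F l' = 0 := by
  have ht := isTent_iff.1 (H.isTent_tent (S.map_mem_V l hx))
  have hp := isPiecewiseHarmonic_succ.1 ht.1
  refine ⟨IsTent.unique (isTent_iff.2 ⟨hp l, ht.2.1, fun y hy hne => ?_⟩) (H.isTent_tent hx),
    fun l' hne => (hp l').eq_zero fun y hy => ?_⟩
  · exact ht.2.2 _ (S.map_mem_V l hy) fun e => hne (S.injective l e)
  · exact ht.2.2 _ (S.map_mem_V l' hy) fun e => hx0 (S.mem_V0_of_map_eq (Ne.symm hne) e.symm)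

theorem tent_nonneg {m : ℕ} {x : K} (hx : x ∈ S.V m) (z : K) : 0 ≤ H.tent m x z := by
  have ht := isTent_iff.1 (H.isTent_tent hx)
  refine (ht.1.mem_Icc (a := 0) (b := 1) (fun y hy => ?_) z).1
  by_cases e : y = x
  · simp [e, ht.2.1]
  · simp [ht.2.2 y hy e]

/-- The tent function of level `m` at `x` lives on the cells of level `m` containing `x`. -/
theorem exists_cell_of_tent_ne_zero {m : ℕ} {x : K} (hx : x ∈ S.V m) {z : K}
    (hz : H.tent m x z ≠ 0) :
    ∃ (w : Fin m → Fin N) (a b : K), S.cellMap w a = x ∧ S.cellMap w b = z := by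
  have ht := isTent_iff.1 (H.isTent_tent hx)
  obtain ⟨w, b, rfl⟩ := S.exists_cellMap_eq m z
  by_contra hcon
  refine hz (congrFun ((ht.1.2 w).eq_zero fun q hq => ?_) b)
  exact ht.2.2 _ (S.cellMap_mem_V w hq) fun e => hcon ⟨w, q, b, e, rfl⟩

variable [MeasurableSpace K] [BorelSpace K] {p : Fin N → ℝ} {μ : Measure K}

theorem integral_tent_pos [IsProbabilityMeasure μ] (hμ : S.IsSelfSimilarMeasure p μ) {m : ℕ} {x : K}
    (hx : x ∈ S.V m) : 0 < ∫ z, H.tent m x z ∂μ := by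
  have ht := H.isTent_tent hx
  have := hμ.isOpenPosMeasure
  exact ht.1.integral_pos_of_hasCompactSupport_nonneg_nonzero
    (HasCompactSupport.of_compactSpace _) (H.tent_nonneg hx) (x := x)
    (by rw [ht.2.2.1]; exact one_ne_zero)

theorem integral_tent_succ_map [IsProbabilityMeasure μ] (hμ : S.IsSelfSimilarMeasure p μ) (m : ℕ)
    (l : Fin N) {x : K} (hx : x ∈ S.V m) (hx0 : x ∉ S.V0) :
    ∫ z, H.tent (m + 1) (S.F l x) z ∂μ = p l * ∫ z, H.tent m x z ∂μ := by
  obtain ⟨h1, h2⟩ := H.tent_succ_map_comp m l hx hx0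
  rw [hμ.integral_eq (H.isTent_tent (S.map_mem_V l hx)).1, Finset.sum_eq_single l]
  · rw [← h1]
    rfl
  · intro l' _ hne
    have : ∀ z, H.tent (m + 1) (S.F l x) (S.F l' z) = 0 := congrFun (h2 l' hne)
    simp [this]
  · exact fun h => absurd (Finset.mem_univ l) h

theorem renormalizedLaplacian_succ_map [IsProbabilityMeasure μ] (hμ : S.IsSelfSimilarMeasure p μ)
    (m : ℕ) (f : K → ℝ) (l : Fin N) {x : K} (hx : x ∈ S.V m) (hx0 : x ∉ S.V0) :
    H.renormalizedLaplacian μ m (f ∘ S.F l) x =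
      H.r l * p l * H.renormalizedLaplacian μ (m + 1) f (S.F l x) := by
  unfold renormalizedLaplacian
  rw [H.integral_tent_succ_map hμ m l hx hx0, H.graphLaplacian_succ_map m f l hx0]
  have h1 := (H.r_pos l).ne'
  have h2 := (hμ.weight_pos l).ne'
  have h3 := (H.integral_tent_pos hμ hx).ne'
  field_simp

/-- A function whose graph Laplacians are the integrals of `g` against the tent functions has
Laplacian `g`. -/
theorem hasLaplacian_of_forall_energy [IsProbabilityMeasure μ] (hμ : S.IsSelfSimilarMeasure p μ)
    {u g : K → ℝ} (hu : Continuous u) (hg : Continuous g)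
    (hE : ∀ m v, H.IsPiecewiseHarmonic m v → (∀ q ∈ S.V0, v q = 0) →
      H.energy m u v = -∫ z, v z * g z ∂μ) : H.HasLaplacian μ u g := by
  refine ⟨hu, hg, fun ε hε => ?_⟩
  obtain ⟨δ, hδ, hgδ⟩ := Metric.uniformContinuous_iff.1
    (CompactSpace.uniformContinuous_of_continuous hg) (ε / 2) (half_pos hε)
  obtain ⟨M, hM⟩ := S.exists_forall_dist_cellMap_lt hδ
  refine ⟨M, fun m hm x hx hx0 => ?_⟩
  have ht := isTent_iff.1 (H.isTent_tent hx)
  have hpos := H.integral_tent_pos hμ hx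
  have hcont := ht.1.1
  have hint : ∀ {φ : K → ℝ}, Continuous φ → Integrable φ μ := fun h =>
    h.integrable_of_compactSpace
  -- The tent is an admissible test function because `x` is not a boundary point.
  have h1 : H.graphLaplacian m u x = ∫ z, H.tent m x z * g z ∂μ := by
    rw [H.graphLaplacian_eq_of_forall ht.2.1 ht.2.2, hE m _ ht.1 fun q hq =>
      ht.2.2 q (S.V0_subset_V m hq) fun e => hx0 (e ▸ hq), neg_neg]
  have h2 : |∫ z, H.tent m x z * (g z - g x) ∂μ| ≤ ε / 2 * ∫ z, H.tent m x z ∂μ := by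
    rw [← integral_const_mul]
    refine (abs_integral_le_integral_abs).trans (integral_mono
      (hint (by fun_prop)) (hint (by fun_prop)) fun z => ?_)
    simp only [abs_mul, abs_of_nonneg (H.tent_nonneg hx z)]
    rw [mul_comm]
    by_cases hz : H.tent m x z = 0
    · simp [hz]
    -- Where the tent does not vanish, the point shares an `m`-cell with `x`, and `g` oscillates
    -- little there.
    · obtain ⟨w, a, b, rfl, rfl⟩ := H.exists_cell_of_tent_ne_zero hx hz
      refine mul_le_mul_of_nonneg_right ?_ (H.tent_nonneg hx _)
      rw [← Real.dist_eq]
      exact (hgδ (hM m hm w b a)).le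
  have h3 : H.renormalizedLaplacian μ m u x - g x =
      (∫ z, H.tent m x z ∂μ)⁻¹ * ∫ z, H.tent m x z * (g z - g x) ∂μ := by
    have : ∫ z, H.tent m x z * (g z - g x) ∂μ =
        ∫ z, H.tent m x z * g z ∂μ - (∫ z, H.tent m x z ∂μ) * g x := by
      rw [← integral_mul_const, ← integral_sub (hint (by fun_prop)) (hint (by fun_prop))]
      simp only [mul_sub]
    rw [this, renormalizedLaplacian, h1, mul_sub, inv_mul_cancel_left₀ hpos.ne']
  rw [h3, abs_mul, abs_of_pos (inv_pos.2 hpos)]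
  calc _ ≤ (∫ z, H.tent m x z ∂μ)⁻¹ * (ε / 2 * ∫ z, H.tent m x z ∂μ) :=
        mul_le_mul_of_nonneg_left h2 (inv_pos.2 hpos).le
    _ = ε / 2 := by field_simp
    _ < ε := half_lt_self hε

variable {H}

/-- Level `m` for `f ∘ S.F l` is level `m + 1` for `f`, and non-boundary vertices go to non-boundary
vertices, so uniform convergence is inherited. -/
theorem HasLaplacian.comp_map [IsProbabilityMeasure μ] (hμ : S.IsSelfSimilarMeasure p μ)
    {f g : K → ℝ} (h : H.HasLaplacian μ f g) (l : Fin N) :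
    H.HasLaplacian μ (f ∘ S.F l) ((H.r l * p l) • (g ∘ S.F l)) := by
  have hpos : 0 < H.r l * p l := mul_pos (H.r_pos l) (hμ.weight_pos l)
  refine ⟨h.1.comp (S.continuous_F l), (h.2.1.comp (S.continuous_F l)).const_smul _,
    fun ε hε => ?_⟩
  obtain ⟨M, hM⟩ := h.2.2 (ε / (H.r l * p l)) (div_pos hε hpos)
  refine ⟨M, fun m hm x hx hx0 => ?_⟩
  have := hM (m + 1) (by omega) _ (S.map_mem_V l hx) (S.map_notMem_V0 l hx0)
  rw [H.renormalizedLaplacian_succ_map hμ m f l hx hx0, Pi.smul_apply, Function.comp_apply,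
    smul_eq_mul, ← mul_sub, abs_mul, abs_of_pos hpos]
  rwa [lt_div_iff₀' hpos] at this

theorem HasLaplacianPow.comp_map [IsProbabilityMeasure μ] (hμ : S.IsSelfSimilarMeasure p μ)
    {n : ℕ} {f g : K → ℝ} (h : H.HasLaplacianPow μ n f g) (l : Fin N) :
    H.HasLaplacianPow μ n (f ∘ S.F l) ((H.r l * p l) ^ n • (g ∘ S.F l)) := by
  induction n generalizing f with
  | zero => exact ⟨h.1.comp (S.continuous_F l), by simp [h.2]⟩
  | succ n ih =>
    obtain ⟨u, h1, h2⟩ := h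
    refine ⟨(H.r l * p l) • (u ∘ S.F l), h1.comp_map hμ l, ?_⟩
    rw [pow_succ', mul_smul (H.r l * p l) ((H.r l * p l) ^ n)]
    exact (ih h2).smul _

theorem HasLaplacianPow.comp_cellMap [IsProbabilityMeasure μ] (hμ : S.IsSelfSimilarMeasure p μ)
    {n : ℕ} {f g : K → ℝ} (h : H.HasLaplacianPow μ n f g) {m : ℕ} (w : Fin m → Fin N) :
    H.HasLaplacianPow μ n (f ∘ S.cellMap w)
      ((wordProd H.r w * wordProd p w) ^ n • (g ∘ S.cellMap w)) := by
  induction m generalizing f g with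
  | zero => simpa [wordProd, cellMap, wordMap] using h
  | succ m ih =>
    have hcomp : ∀ φ : K → ℝ, φ ∘ S.cellMap w = (φ ∘ S.F (w 0)) ∘ S.cellMap (Fin.tail w) :=
      fun φ => rfl
    have hprod : ∀ t : Fin N → ℝ, wordProd t w = t (w 0) * wordProd t (Fin.tail w) := fun t => by
      rw [← wordProd_cons, Fin.cons_self_tail]
    rw [hcomp, hcomp, hprod, hprod, mul_mul_mul_comm, mul_pow, mul_comm, mul_smul]
    exact ih (h.comp_map hμ (w 0)) (Fin.tail w)

end SelfSimilarStructure.HarmonicStructure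

/-! ### The Green operator and the Poisson equation -/

theorem abs_integral_mul_le {X : Type*} [MeasurableSpace X] {μ : Measure X}
    [IsProbabilityMeasure μ] {v g : X → ℝ} {B M : ℝ} (hv : ∀ x, |v x| ≤ B) (hM : ∀ x, |g x| ≤ M) :
    |∫ x, v x * g x ∂μ| ≤ B * M := by
  have := norm_integral_le_of_norm_le_const (μ := μ) (f := fun x => v x * g x) (C := B * M)
    (Eventually.of_forall fun x => by
      rw [Real.norm_eq_abs, abs_mul]
      exact mul_le_mul (hv x) (hM x) (abs_nonneg _) ((abs_nonneg _).trans (hv x)))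
  simpa using this

namespace SelfSimilarStructure

section

variable {K : Type*} [MetricSpace K] {N : ℕ} {S : SelfSimilarStructure K N}

/-- The successive approximations of the Green operator, obtained from the solution operator `P`
of the first-level Dirichlet problem by self-similarity. -/
noncomputable def greenApprox (S : SelfSimilarStructure K N) (t : Fin N → ℝ)
    (P : (K → ℝ) → K → ℝ) : ℕ → (K → ℝ) → K → ℝ
  | 0, _ => 0
  | k + 1, g => P g + S.glue fun l => t l • greenApprox S t P k (g ∘ S.F l)

variable {t : Fin N → ℝ} {P : (K → ℝ) → K → ℝ}

theorem greenApprox_eq (hP0 : ∀ g, Continuous g → ∀ q ∈ S.V0, P g q = 0)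
    (k : ℕ) (g : K → ℝ) (hg : Continuous g) :
    (∀ q ∈ S.V0, greenApprox S t P k g q = 0) ∧
      ∀ l y, greenApprox S t P (k + 1) g (S.F l y) =
        P g (S.F l y) + t l * greenApprox S t P k (g ∘ S.F l) y := by
  have hglue : ∀ k, (∀ g, Continuous g → ∀ q ∈ S.V0, greenApprox S t P k g q = 0) → ∀ g,
      Continuous g → ∀ l y, greenApprox S t P (k + 1) g (S.F l y) =
        P g (S.F l y) + t l * greenApprox S t P k (g ∘ S.F l) y := fun k hk g hg l y => by
    have hcomp : S.Compatible fun l => t l • greenApprox S t P k (g ∘ S.F l) :=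
      S.compatible_of_eq 0 fun l q hq => by
        simp [hk _ (hg.comp (S.continuous_F l)) q hq]
    rw [greenApprox, Pi.add_apply, hcomp.glue_apply]
    rfl
  have hb : ∀ k g, Continuous g → ∀ q ∈ S.V0, greenApprox S t P k g q = 0 := by
    intro k
    induction k with
    | zero => exact fun _ _ _ _ => rfl
    | succ k ih =>
      intro g hg q hq
      obtain ⟨l, hl⟩ := S.fixed q hq
      conv_lhs => rw [← hl]
      rw [hglue k ih g hg, ih _ (hg.comp (S.continuous_F l)) q hq, hl, hP0 g hg q hq, mul_zero,
        add_zero]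
  exact ⟨hb k g hg, hglue k (hb k) g hg⟩

theorem continuous_greenApprox [CompactSpace K]
    (hP0 : ∀ g, Continuous g → ∀ q ∈ S.V0, P g q = 0)
    (hP : ∀ g, Continuous g → Continuous (P g)) (k : ℕ) {g : K → ℝ} (hg : Continuous g) :
    Continuous (greenApprox S t P k g) := by
  induction k generalizing g with
  | zero => exact continuous_zero
  | succ k ih =>
    refine S.continuous_of_comp fun l => ?_
    rw [show greenApprox S t P (k + 1) g ∘ S.F l =
        fun y => P g (S.F l y) + t l * greenApprox S t P k (g ∘ S.F l) y from
      funext ((greenApprox_eq hP0 k g hg).2 l)]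
    have h1 := hP g hg
    have h2 := ih (hg.comp (S.continuous_F l))
    have h3 := S.continuous_F l
    fun_prop

/-- Descending to a cell replaces `g` by `g ∘ S.F l`, which obeys the same bound `M`, and gains a
factor `|t l| ≤ ρ`. -/
theorem abs_greenApprox_succ_sub_le
    (hP0 : ∀ g, Continuous g → ∀ q ∈ S.V0, P g q = 0) {C ρ M : ℝ}
    (hC : ∀ g, Continuous g → ∀ M, (∀ x, |g x| ≤ M) → ∀ x, |P g x| ≤ C * M)
    (ht : ∀ l, |t l| ≤ ρ) (k : ℕ) {g : K → ℝ} (hg : Continuous g) (hM : ∀ x, |g x| ≤ M) (x : K) :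
    |greenApprox S t P (k + 1) g x - greenApprox S t P k g x| ≤ C * M * ρ ^ k := by
  induction k generalizing g x with
  | zero =>
    obtain ⟨l, y, rfl⟩ := S.exists_map_eq x
    rw [(greenApprox_eq hP0 0 g hg).2]
    simpa [greenApprox] using hC g hg M hM (S.F l y)
  | succ k ih =>
    obtain ⟨l, y, rfl⟩ := S.exists_map_eq x
    rw [(greenApprox_eq hP0 (k + 1) g hg).2, (greenApprox_eq hP0 k g hg).2,
      add_sub_add_left_eq_sub, ← mul_sub, abs_mul]
    calc _ ≤ ρ * (C * M * ρ ^ k) :=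
          mul_le_mul (ht l) (ih (hg.comp (S.continuous_F l)) (fun z => hM _) y) (abs_nonneg _)
            ((abs_nonneg _).trans (ht l))
      _ = _ := by ring

end

end SelfSimilarStructure

namespace SelfSimilarStructure.HarmonicStructure

variable {K : Type*} [MetricSpace K] [CompactSpace K] [ConnectedSpace K] [Nontrivial K]
  [MeasurableSpace K] [BorelSpace K] {N : ℕ} {S : SelfSimilarStructure K N}
  (H : S.HarmonicStructure) {p : Fin N → ℝ} {μ : Measure K}

/-- Solution of the Dirichlet problem on the first level, with a bound. -/
theorem exists_dirichlet_solution (μ : Measure K) [IsProbabilityMeasure μ] :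
    ∃ C : ℝ, 0 ≤ C ∧ ∀ g : K → ℝ, Continuous g → ∃ u ∈ H.dirichletSpace,
      (∀ v ∈ H.dirichletSpace, H.energy 1 u v = -∫ x, v x * g x ∂μ) ∧
      ∀ M, (∀ x, |g x| ≤ M) → ∀ x, |u x| ≤ C * M := by
  -- `e x` represents evaluation at `x`: it is a first-level Green function.
  choose e he hev using fun x => H.exists_dirichlet_representer
    ((LinearMap.proj (R := ℝ) (φ := fun _ : K => ℝ) x).comp H.dirichletSpace.subtype)
  have hbd : ∀ x, ∃ B, ∀ z, |e x z| ≤ B := fun x => by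
    obtain ⟨B, hB⟩ := isCompact_univ.exists_bound_of_continuousOn (he x).1.1.continuousOn
    exact ⟨B, fun z => hB z (Set.mem_univ z)⟩
  choose B hB using hbd
  have hB0 : ∀ x, 0 ≤ B x := fun x => (abs_nonneg _).trans (hB x x)
  refine ⟨∑ x ∈ S.V 1, B x, Finset.sum_nonneg fun x _ => hB0 x, fun g hg => ?_⟩
  have hint : ∀ v : H.dirichletSpace, Integrable (fun x => (v : K → ℝ) x * g x) μ := fun v =>
    (v.2.1.1.mul hg).integrable_of_compactSpace
  let L : H.dirichletSpace →ₗ[ℝ] ℝ :=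
    { toFun := fun v => -∫ x, (v : K → ℝ) x * g x ∂μ
      map_add' := fun v v' => by
        have : ∀ x, ((v + v' : H.dirichletSpace) : K → ℝ) x * g x =
            (v : K → ℝ) x * g x + (v' : K → ℝ) x * g x := fun x => add_mul _ _ _
        simp only [this]
        rw [integral_add (hint v) (hint v'), neg_add]
      map_smul' := fun t v => by
        have : ∀ x, ((t • v : H.dirichletSpace) : K → ℝ) x * g x =
            t * ((v : K → ℝ) x * g x) := fun x => mul_assoc _ _ _
        simp only [this]
        rw [integral_const_mul, RingHom.id_apply, smul_eq_mul, mul_neg] }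
  obtain ⟨u, hu, huL⟩ := H.exists_dirichlet_representer L
  have huv : ∀ v ∈ H.dirichletSpace, H.energy 1 u v = -∫ x, v x * g x ∂μ := fun v hv =>
    (H.energy_comm 1 u v).trans (huL ⟨v, hv⟩)
  refine ⟨u, hu, huv, fun M hM x => ?_⟩
  have hM0 : 0 ≤ M := (abs_nonneg _).trans (hM x)
  -- By the maximum principle it suffices to bound `u` on `V 1`, where u(y) = E_1(u, e_y) = -∫ e_y
  -- g.
  refine abs_le.2 (hu.1.mem_Icc (fun y hy => abs_le.1 ?_) x)
  have h1 : H.energy 1 u (e y) = u y := hev y ⟨u, hu⟩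
  rw [← h1, huv _ (he y), abs_neg]
  refine (abs_integral_mul_le (hB y) hM).trans (mul_le_mul_of_nonneg_right ?_ hM0)
  exact Finset.single_le_sum (f := B) (fun x _ => hB0 x) hy

/-- The weak form of the Poisson equation is inherited from the first-level cells. -/
theorem energy_eq_neg_integral [IsProbabilityMeasure μ] (hμ : S.IsSelfSimilarMeasure p μ)
    {P G : (K → ℝ) → K → ℝ} (hP : ∀ g, Continuous g → P g ∈ H.dirichletSpace)
    (hPE : ∀ g, Continuous g → ∀ v ∈ H.dirichletSpace, H.energy 1 (P g) v = -∫ x, v x * g x ∂μ)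
    (hG0 : ∀ g, Continuous g → ∀ q ∈ S.V0, G g q = 0)
    (hG : ∀ g, Continuous g → ∀ l,
      G g ∘ S.F l = P g ∘ S.F l + (H.r l * p l) • G (g ∘ S.F l)) (m : ℕ) {g v : K → ℝ}
    (hg : Continuous g) (hv : H.IsPiecewiseHarmonic m v) (hv0 : ∀ q ∈ S.V0, v q = 0) :
    H.energy m (G g) v = -∫ x, v x * g x ∂μ := by
  induction m generalizing g v with
  | zero =>
    have : v = 0 := hv.eq_zero (S.V_zero.symm ▸ hv0)
    rw [H.energy_eq_zero_of_right (S.V_zero.symm ▸ hv0), this]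
    simp
  | succ m ih =>
    -- Split `v` as `v₁ + (v - v₁)`. In each cell, harmonicity makes `P g` see only `v₁`, while the
    -- rescaled Green part sees only `v - v₁`, which vanishes on the cell boundary, so the induction
    -- hypothesis applies.
    obtain ⟨v₁, hv₁, hvv⟩ := H.exists_isPiecewiseHarmonic 1 v
    have hv₁0 : ∀ q ∈ S.V0, v₁ q = 0 := fun q hq => (hvv q (S.V0_subset_V 1 hq)).trans (hv0 q hq)
    have hcell : ∀ l, H.energy m (G g ∘ S.F l) (v ∘ S.F l) =
        H.energy 0 (P g ∘ S.F l) (v₁ ∘ S.F l) -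
          H.r l * p l * ∫ x, (v (S.F l x) - v₁ (S.F l x)) * g (S.F l x) ∂μ := fun l => by
      have hgl := hg.comp (S.continuous_F l)
      have hPl : H.IsHarmonic (P g ∘ S.F l) :=
        isPiecewiseHarmonic_zero.1 (isPiecewiseHarmonic_succ.1 (hP g hg).1 l)
      have hvl : H.IsHarmonic (v₁ ∘ S.F l) :=
        isPiecewiseHarmonic_zero.1 (isPiecewiseHarmonic_succ.1 hv₁ l)
      have heq : ∀ q ∈ S.V0, (v ∘ S.F l) q = (v₁ ∘ S.F l) q := fun q hq =>
        (hvv _ (S.map_mem_V l (S.V_zero.symm ▸ hq))).symm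
      have h1 : H.energy m (P g ∘ S.F l) (v ∘ S.F l) =
          H.energy 0 (P g ∘ S.F l) (v₁ ∘ S.F l) := by
        rw [hPl.energy_eq]
        exact H.energy_congr (fun _ _ => rfl) (S.V_zero.symm ▸ heq)
      have h2 : H.energy m (G (g ∘ S.F l)) (v₁ ∘ S.F l) = 0 := by
        rw [H.energy_comm, hvl.energy_eq]
        exact H.energy_eq_zero_of_right (S.V_zero.symm ▸ hG0 _ hgl)
      have h3 := ih hgl ((isPiecewiseHarmonic_succ.1 hv l).sub (hvl.isPiecewiseHarmonic m))
        fun q hq => sub_eq_zero.2 (heq q hq)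
      rw [energy_sub_right, h2, sub_zero] at h3
      rw [hG g hg, energy_add_left, energy_smul_left, h1, h3, mul_neg, sub_eq_add_neg]
      rfl
    have hsum : ∑ l, (H.r l)⁻¹ * H.energy 0 (P g ∘ S.F l) (v₁ ∘ S.F l) =
        -∫ x, v₁ x * g x ∂μ := by
      rw [← energy_succ]
      exact hPE g hg v₁ ⟨hv₁, hv₁0⟩
    have hvc := hv.1
    have hv₁c := hv₁.1
    have hint : ∑ l, p l * ∫ x, (v (S.F l x) - v₁ (S.F l x)) * g (S.F l x) ∂μ =
        ∫ x, v x * g x ∂μ - ∫ x, v₁ x * g x ∂μ := by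
      rw [← hμ.integral_eq (φ := fun x => (v x - v₁ x) * g x) (by fun_prop),
        ← integral_sub (Continuous.integrable_of_compactSpace (by fun_prop))
          (Continuous.integrable_of_compactSpace (by fun_prop))]
      simp only [sub_mul]
    rw [energy_succ]
    simp only [hcell]
    rw [Finset.sum_congr rfl fun l _ => mul_sub (H.r l)⁻¹ _ _]
    rw [Finset.sum_sub_distrib, hsum]
    -- The factor `r l` of the Green recursion cancels the energy scaling, leaving the weights `p l`
    -- of the integral identity.
    have hcancel : ∀ l, (H.r l)⁻¹ * (H.r l * p l *
        ∫ x, (v (S.F l x) - v₁ (S.F l x)) * g (S.F l x) ∂μ) =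
        p l * ∫ x, (v (S.F l x) - v₁ (S.F l x)) * g (S.F l x) ∂μ := fun l => by
      rw [mul_assoc, inv_mul_cancel_left₀ (H.r_pos l).ne']
    rw [Finset.sum_congr rfl fun l _ => hcancel l, hint]
    ring

/-- The Poisson equation `Δ_μ u = g` has a solution bounded by a multiple of the supremum
of `g`. -/
theorem exists_hasLaplacian [IsProbabilityMeasure μ] (hμ : S.IsSelfSimilarMeasure p μ) :
    ∃ C : ℝ, 0 ≤ C ∧ ∀ g : K → ℝ, Continuous g → ∃ u : K → ℝ, H.HasLaplacian μ u g ∧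
      ∀ M, (∀ x, |g x| ≤ M) → ∀ x, |u x| ≤ C * M := by
  classical
  obtain ⟨C, hC0, hex⟩ := H.exists_dirichlet_solution μ
  choose! P hP hPE hPC using hex
  have hP0 : ∀ g, Continuous g → ∀ q ∈ S.V0, P g q = 0 := fun g hg => (hP g hg).2
  have hPc : ∀ g, Continuous g → Continuous (P g) := fun g hg => (hP g hg).1.1
  obtain ⟨ρ, hρ0, hρ1, hρ⟩ := exists_uniform_bound H.r H.r_lt_one
  set t : Fin N → ℝ := fun l => H.r l * p l with ht
  have htρ : ∀ l, |t l| ≤ ρ := fun l => by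
    rw [abs_of_pos (mul_pos (H.r_pos l) (hμ.weight_pos l))]
    exact (mul_le_of_le_one_right (H.r_pos l).le (hμ.weight_le_one l)).trans (hρ l)
  have hlim : ∀ g, Continuous g → ∃ u : K → ℝ, Continuous u ∧
      (∀ x, Tendsto (fun k => greenApprox S t P k g x) atTop (𝓝 (u x))) ∧
      ∀ M, (∀ x, |g x| ≤ M) → ∀ x, |u x| ≤ C / (1 - ρ) * M := fun g hg => by
    have key : ∀ M, (∀ x, |g x| ≤ M) → _ := fun M hM =>
      exists_continuous_limit hρ0 hρ1 (continuous_greenApprox hP0 hPc (t := t) · hg)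
        (abs_greenApprox_succ_sub_le hP0 hPC htρ · hg hM)
    obtain ⟨M₀, hM₀⟩ := isCompact_univ.exists_bound_of_continuousOn hg.continuousOn
    obtain ⟨u, huc, hu, -⟩ := key M₀ fun x => hM₀ x (Set.mem_univ x)
    -- The limit is constructed with one bound `M₀`; by uniqueness of limits it obeys the estimate
    -- for every bound `M`.
    refine ⟨u, huc, hu, fun M hM x => ?_⟩
    obtain ⟨u', -, hu', hb⟩ := key M hM
    rw [tendsto_nhds_unique (hu x) (hu' x), div_mul_eq_mul_div]
    simpa [greenApprox] using hb x
  choose! G hGc hGlim hGC using hlim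
  refine ⟨C / (1 - ρ), div_nonneg hC0 (by linarith), fun g hg => ⟨G g, ?_, hGC g hg⟩⟩
  have hG0 : ∀ g, Continuous g → ∀ q ∈ S.V0, G g q = 0 := fun g hg q hq =>
    tendsto_nhds_unique (hGlim g hg q)
      (by simp only [(greenApprox_eq hP0 _ g hg).1 q hq, tendsto_const_nhds])
  have hG : ∀ g, Continuous g → ∀ l,
      G g ∘ S.F l = P g ∘ S.F l + (H.r l * p l) • G (g ∘ S.F l) := fun g hg l =>
    funext fun y => by
      refine tendsto_nhds_unique ((tendsto_add_atTop_iff_nat 1).2 (hGlim g hg (S.F l y))) ?_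
      simp only [(greenApprox_eq hP0 _ g hg).2]
      exact ((hGlim _ (hg.comp (S.continuous_F l)) y).const_mul (t l)).const_add _
  exact H.hasLaplacian_of_forall_energy hμ (hGc g hg) hg fun m v hv hv0 =>
    H.energy_eq_neg_integral hμ hP hPE hG0 hG m hg hv hv0

/-- The Poisson equation is solved `n` times, each solution serving as the next right-hand side, so
the constants multiply to `C ^ n`. -/
theorem exists_hasLaplacianPow [IsProbabilityMeasure μ] (hμ : S.IsSelfSimilarMeasure p μ) (n : ℕ) :
    ∃ C : ℝ, 0 ≤ C ∧ ∀ g : K → ℝ, Continuous g → ∃ u : K → ℝ, H.HasLaplacianPow μ n u g ∧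
      ∀ M, (∀ x, |g x| ≤ M) → ∀ x, |u x| ≤ C * M := by
  obtain ⟨C, hC0, hC⟩ := H.exists_hasLaplacian hμ
  refine ⟨C ^ n, pow_nonneg hC0 n, fun g hg => ?_⟩
  induction n with
  | zero => exact ⟨g, ⟨hg, rfl⟩, fun M hM x => by simpa using hM x⟩
  | succ n ih =>
    obtain ⟨u, hu, hub⟩ := ih
    have huc : Continuous u := by
      cases n with
      | zero => exact hu.1
      | succ n =>
        obtain ⟨_, h, -⟩ := hu
        exact h.1
    obtain ⟨u', hu', hub'⟩ := hC u huc
    refine ⟨u', ⟨u, hu', hu⟩, fun M hM x => ?_⟩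
    rw [pow_succ', mul_assoc]
    exact hub' _ (hub M hM) x

end SelfSimilarStructure.HarmonicStructure

end PCF

/-! ### The blow-up argument -/

theorem theorem5p4 {K : Type*} [MetricSpace K] [CompactSpace K] [ConnectedSpace K]
    [Nontrivial K] [MeasurableSpace K] [BorelSpace K] {N : ℕ}
    (S : PCF.SelfSimilarStructure K N) (H : S.HarmonicStructure)
    (p : Fin N → ℝ) (μ : Measure K) [IsProbabilityMeasure μ] (hμ : S.IsSelfSimilarMeasure p μ)
    (n : ℕ) (hn : 1 ≤ n) (l : ℕ) (y : Fin l → K) (hy : ∀ j, y j ∈ S.Vstar)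
    (a : Fin l → ℝ) (A : ℝ) (hA : A ≠ 0)
    (h_annihilate : ∀ h : K → ℝ, H.IsMultiharmonic μ n h → ∑ j, a j * h (y j) = 0)
    (h_const : ∀ h' : K → ℝ, H.HasLaplacianPow μ n h' (fun _ => 1) → ∑ j, a j * h' (y j) = A)
    (f g : K → ℝ) (hf : H.HasLaplacianPow μ n f g) :
    TendstoUniformlyOn
      (fun (m : ℕ) (z : K × (ℕ → Fin N)) =>
        A⁻¹ * ((PCF.wordProd H.r (PCF.truncate z.2 m) *
            PCF.wordProd p (PCF.truncate z.2 m)) ^ n)⁻¹ *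
          ∑ j, a j * f (S.cellMap (PCF.truncate z.2 m) (y j)))
      (fun z => g z.1) atTop {z | S.IsAddress z.2 z.1} := by
  obtain ⟨C, hC0, hC⟩ := H.exists_hasLaplacianPow hμ n
  obtain ⟨h₁, hh₁, -⟩ := hC (fun _ => 1) continuous_const
  have hg : Continuous g := hf.continuous_right
  rw [Metric.tendstoUniformlyOn_iff]
  intro ε hε
  set B : ℝ := |A⁻¹| * ∑ j, |a j| * C with hB
  have hB0 : 0 ≤ B := by positivity
  -- `B` bounds the effect of the functional on solutions with right-hand side of size one; it may
  -- be zero, hence `B + 1`.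
  have hε' : 0 < ε / (B + 1) := by positivity
  obtain ⟨δ, hδ, hgδ⟩ := Metric.uniformContinuous_iff.1
    (CompactSpace.uniformContinuous_of_continuous hg) _ hε'
  obtain ⟨M, hM⟩ := S.exists_forall_dist_cellMap_lt hδ
  filter_upwards [eventually_ge_atTop M] with m hm
  rintro ⟨x, ω⟩ hx
  obtain ⟨x', hx'⟩ : x ∈ Set.range (S.cellMap (PCF.truncate ω m)) := hx m
  dsimp only
  -- From here on only the word `w` of length `m ≥ M` matters; `M` depends on neither the point nor
  -- its address, whence the uniformity.
  generalize PCF.truncate ω m = w at hx' ⊢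
  subst hx'
  set x := S.cellMap w x'
  set c : ℝ := (PCF.wordProd H.r w * PCF.wordProd p w) ^ n with hc
  have hc0 : c ≠ 0 := pow_ne_zero _
    (mul_pos (PCF.wordProd_pos H.r_pos w) (PCF.wordProd_pos hμ.weight_pos w)).ne'
  set k : K → ℝ := fun z => g (S.cellMap w z) - g x with hk
  have hkb : ∀ z, |k z| ≤ ε / (B + 1) := fun z => by
    rw [hk, ← Real.dist_eq]
    exact (hgδ (hM m hm w z x')).le
  obtain ⟨u, hu, hub⟩ := hC k ((hg.comp (S.continuous_cellMap w)).sub continuous_const)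
  -- The n-th Laplacians of the three terms are g∘F_w, -g(x) and -(g∘F_w - g(x)), with sum zero.
  have hharm : H.IsMultiharmonic μ n
      (c⁻¹ • (f ∘ S.cellMap w) + (-g x) • h₁ + (-1 : ℝ) • u) := by
    have := (((hf.comp_cellMap hμ w).smul c⁻¹).add_smul hh₁ (-g x)).add_smul hu (-1)
    change H.HasLaplacianPow μ n _ 0
    convert this using 1
    funext z
    simp only [Pi.add_apply, Pi.smul_apply, Pi.zero_apply, Function.comp_apply, smul_eq_mul, hk]
    rw [inv_mul_cancel_left₀ hc0]
    ring
  have h0 := h_annihilate _ hharm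
  have h1 := h_const h₁ hh₁
  have hsum : c⁻¹ * ∑ j, a j * f (S.cellMap w (y j)) = g x * A + ∑ j, a j * u (y j) := by
    rw [← h1, Finset.mul_sum, Finset.mul_sum, ← Finset.sum_add_distrib, ← sub_eq_zero,
      ← Finset.sum_sub_distrib, ← h0]
    refine Finset.sum_congr rfl fun j _ => ?_
    simp only [Pi.add_apply, Pi.smul_apply, Function.comp_apply, smul_eq_mul]
    ring
  have hdiff : A⁻¹ * c⁻¹ * ∑ j, a j * f (S.cellMap w (y j)) - g x =
      A⁻¹ * ∑ j, a j * u (y j) := by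
    rw [mul_assoc, hsum]
    field_simp
    ring
  have hle : |∑ j, a j * u (y j)| ≤ (∑ j, |a j| * C) * (ε / (B + 1)) := by
    rw [Finset.sum_mul]
    refine (Finset.abs_sum_le_sum_abs _ _).trans (Finset.sum_le_sum fun j _ => ?_)
    rw [abs_mul, mul_assoc]
    exact mul_le_mul_of_nonneg_left (hub _ hkb _) (abs_nonneg _)
  rw [dist_comm, Real.dist_eq, hdiff, abs_mul]
  calc _ ≤ |A⁻¹| * ((∑ j, |a j| * C) * (ε / (B + 1))) :=
        mul_le_mul_of_nonneg_left hle (abs_nonneg _)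
    _ = B * (ε / (B + 1)) := by rw [hB]; ring
    _ < (B + 1) * (ε / (B + 1)) := mul_lt_mul_of_pos_right (lt_add_one B) hε'
    _ = ε := by field_simp
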